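/- Let $A=\begin{pmatrix}0&-1\\1&0\end{pmatrix}$ and $B=\begin{pmatrix}1&-1\\1&0\end{pmatrix}$ be the standard generators, of orders two and three, of $PSL(2,\mathbb Z)\cong\mathbb Z_2*\mathbb Z_3$. A reciprocal geodesic on the modular surface $\mathbb H/PSL(2,\mathbb Z)$ (powers included) is identified with the conjugacy class in $PSL(2,\mathbb Z)$ of a hyperbolic element whose axis passes through a point of $\mathbb H$ fixed by an element of order two. Its word length $|\gamma|$ is the minimal word length, with respect to $A,B,B^{-1}$, of the elements of that conjugacy class. The conjugacy class of a hyperbolic element contains an element in normal form $AB^{\epsilon_1}\cdots AB^{\epsilon_k}$ with $\epsilon_i=\pm1$ and $\epsilon_1\ne\epsilon_k$, unique up to a cyclic shift of the signs; the geodesic has exactly $m$ cusp excursions of depth greater than $D$ if exactly $m$ of the maximal runs of consecutive equal signs in $(\epsilon_1,\dots,\epsilon_k)$ have length greater than $D$. Let $\mathcal E_2^D$ be the set of reciprocal geodesics with exactly two cusp excursions of depth greater than $D$. **Theorem.** Let $D\ge 2$ be an integer. The polynomial $z^D-z^{D-1}-\cdots-z-1$ has a unique positive root $\alpha_D$; for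 every $t$ the set $\{\gamma\in\mathcal E_2^D:|\gamma|=4t\}$ is finite; and $$\frac{\bigl|\{\gamma\in\mathcal E_2^D:|\gamma|=4t\}\bigr|}{t\,\alpha_D^{\,t}}\;\longrightarrow\;\frac{d_D^2}{\alpha_D^{D}(\alpha_D-1)}\qquad(t\to\infty),\qquad\text{where } d_D=\frac{\alpha_D-1}{2+(D+1)(\alpha_D-2)} .$$ -/

import Mathlib

open Filter Topology

namespace ReciprocalGeodesics

/-- The modular group `PSL(2, ℤ)`. -/
abbrev PSL2Z : Type := Matrix.ProjectiveSpecialLinearGroup (Fin 2) ℤ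

/-- The projection `SL(2, ℤ) → PSL(2, ℤ)`. -/
def proj : Matrix.SpecialLinearGroup (Fin 2) ℤ →* PSL2Z :=
  QuotientGroup.mk' _

/-- The matrix of the generator `A`. -/
def matA : Matrix.SpecialLinearGroup (Fin 2) ℤ :=
  ⟨!![0, -1; 1, 0], by simp [Matrix.det_fin_two]⟩

/-- The matrix of the generator `B`. -/
def matB : Matrix.SpecialLinearGroup (Fin 2) ℤ :=
  ⟨!![1, -1; 1, 0], by simp [Matrix.det_fin_two]⟩

/-- The generator `A` of order two of the modular group. -/
def A : PSL2Z := proj matA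

/-- The generator `B` of order three of the modular group. -/
def B : PSL2Z := proj matB

/-- The word length of an element of `PSL(2, ℤ)` with respect to `A`, `B`, `B⁻¹`. -/
noncomputable def elementLength (g : PSL2Z) : ℕ :=
  sInf {n | ∃ w : List PSL2Z, (∀ s ∈ w, s = A ∨ s = B ∨ s = B⁻¹) ∧ w.prod = g ∧ w.length = n}

/-- The word length of a conjugacy class: the minimal word length of its elements. -/
noncomputable def wordLength (c : ConjClasses PSL2Z) : ℕ :=
  sInf {n | ∃ g : PSL2Z, ConjClasses.mk g = c ∧ elementLength g = n}

/-- A matrix in `SL(2, ℤ)` is hyperbolic if its trace has absolute value greater than two. -/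
def IsHyperbolic (h : Matrix.SpecialLinearGroup (Fin 2) ℤ) : Prop :=
  2 < |Matrix.trace (h : Matrix (Fin 2) (Fin 2) ℤ)|

/-- The axis in the hyperbolic plane of a hyperbolic isometry: the geodesic along which it
translates, which is the set of the points that it displaces least. -/
def axis (h : Matrix.SpecialLinearGroup (Fin 2) ℤ) : Set UpperHalfPlane :=
  {z | ∀ w : UpperHalfPlane, dist z (h • z) ≤ dist w (h • w)}

/-- The point `z` is fixed by an element of order two of the modular group. -/
def IsOrderTwoPoint (z : UpperHalfPlane) : Prop :=
  ∃ k : Matrix.SpecialLinearGroup (Fin 2) ℤ, orderOf (proj k) = 2 ∧ k • z = z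

/-- A reciprocal geodesic on the modular surface, given by its lift: the conjugacy class in
`PSL(2, ℤ)` of a hyperbolic element whose axis passes through an order two fixed point.
Powers are allowed. -/
def IsReciprocal (c : ConjClasses PSL2Z) : Prop :=
  ∃ h : Matrix.SpecialLinearGroup (Fin 2) ℤ,
    IsHyperbolic h ∧ ConjClasses.mk (proj h) = c ∧ ∃ z ∈ axis h, IsOrderTwoPoint z

/-- The element `A B^ε₁ A B^ε₂ ⋯ A B^εₖ` of the modular group, where each `εᵢ` is a sign. -/
def signWord (ε : List ℤˣ) : PSL2Z :=
  (ε.map fun e => A * B ^ (e : ℤ)).prod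

/-- The run sequence of a tuple of signs: the lengths, in order, of its maximal blocks of
consecutive equal signs. -/
def runs (ε : List ℤˣ) : List ℕ :=
  (ε.splitBy (· == ·)).map List.length

/-- The signs `ε₁, …, εₖ` form a normal form of the class `c`: `ε₁ ≠ εₖ`, and
`A B^ε₁ ⋯ A B^εₖ` belongs to `c`. -/
def IsNormalForm (ε : List ℤˣ) (c : ConjClasses PSL2Z) : Prop :=
  ε.head? ≠ ε.getLast? ∧ ConjClasses.mk (signWord ε) = c

/-- The closed geodesic `c` has exactly `k` cusp excursions of depth greater than `D`: the run
sequence of its normal form (unique up to a cyclic shift) has exactly `k` parts greater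
than `D`. -/
def HasExcursions (D k : ℕ) (c : ConjClasses PSL2Z) : Prop :=
  ∃ ε : List ℤˣ, IsNormalForm ε c ∧ (runs ε).countP (fun r => D < r) = k

/-- The set of the reciprocal geodesics with exactly `k` cusp excursions of depth greater
than `D`. -/
def excursionSet (D k : ℕ) : Set (ConjClasses PSL2Z) :=
  {c | IsReciprocal c ∧ HasExcursions D k c}

/-- `α` is a positive root of the polynomial `z ^ D - z ^ (D - 1) - ⋯ - 1`. -/
def IsPosRoot (D : ℕ) (α : ℝ) : Prop :=
  0 < α ∧ α ^ D - ∑ i ∈ Finset.range D, α ^ i = 0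

/-- The constant `d_D`, as a function of `D` and of the root `α = α_D`. -/
noncomputable def dConst (D : ℕ) (α : ℝ) : ℝ :=
  (α - 1) / (2 + ((D : ℝ) + 1) * (α - 2))

end ReciprocalGeodesics

/-!
A hyperbolic class is reciprocal exactly when it contains a product of two elements of order two.
Both are conjugate to `A`, and moving one of them to `A` shows that the class is represented by a
symmetric sign sequence: a word `l` followed by its reversed negation. Such a class has word length
`4 * l.length` and twice as many long runs as `l`, so two excursions mean exactly one long run in
`l`. That run pins `l` down in the cyclic word up to reversed negation, so the classes are counted
by half the number of such words, that is, by the compositions of `t` (the run lengths) having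
exactly one part greater than `D`.

If `S` and `L` are the generating functions of the parts at most `D` and greater than `D`, these
compositions have generating function `L / (1 - S) ^ 2`. After rescaling by the root `α` of
`z ^ D = z ^ (D - 1) + ⋯ + 1`, the parts of `S` become a probability distribution, so by renewal
the coefficients of `1 / (1 - S)` tend to the reciprocal mean `d`; the square contributes
`t * d ^ 2` and `L` contributes its total mass `1 / (α ^ D * (α - 1))`.
-/

namespace ReciprocalGeodesics

open scoped MatrixGroups

/-! ### The modular group and its generators -/

lemma proj_surjective : Function.Surjective proj := QuotientGroup.mk'_surjective _

lemma proj_eq_proj_iff {X Y : SL(2, ℤ)} : proj X = proj Y ↔ X = Y ∨ X = -Y := by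
  have hmem : proj X = proj Y ↔ X⁻¹ * Y ∈ Subgroup.center SL(2, ℤ) := QuotientGroup.eq
  have hone (Z : SL(2, ℤ)) : 1 = Z.1 ↔ Z = 1 :=
    ⟨fun h => Subtype.ext h.symm, by rintro rfl; rfl⟩
  have hneg (Z : SL(2, ℤ)) : -1 = Z.1 ↔ Z = -1 :=
    ⟨fun h => Subtype.ext (by simp [← h]), by rintro rfl; simp⟩
  have hcenter (Z : SL(2, ℤ)) : Z ∈ Subgroup.center SL(2, ℤ) ↔ Z = 1 ∨ Z = -1 := by
    simp [Matrix.SpecialLinearGroup.mem_center_iff, or_and_right, exists_or, hone, hneg]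
  rw [hmem, hcenter, inv_mul_eq_one, inv_mul_eq_iff_eq_mul, mul_neg_one, eq_comm (a := Y),
    neg_eq_iff_eq_neg]

lemma A_mul_A : A * A = 1 := by
  rw [A, ← map_mul, ← map_one proj, proj_eq_proj_iff]
  exact Or.inr (by decide)

lemma A_mul_A_mul (g : PSL2Z) : A * (A * g) = g := by rw [← mul_assoc, A_mul_A, one_mul]

lemma A_inv : A⁻¹ = A := inv_eq_of_mul_eq_one_left A_mul_A

lemma B_pow_three : B ^ 3 = 1 := by
  rw [B, ← map_pow, ← map_one proj, proj_eq_proj_iff]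
  exact Or.inr (by decide)

lemma B_zpow_mul_self (e : ℤˣ) : B ^ (e : ℤ) * B ^ (e : ℤ) = B ^ ((-e : ℤˣ) : ℤ) := by
  have h : B ^ (3 : ℤ) = 1 := B_pow_three
  rcases Int.units_eq_one_or e with rfl | rfl
  · calc B ^ (1 : ℤ) * B ^ (1 : ℤ) = B ^ (3 : ℤ) * B ^ (-1 : ℤ) := by simp only [← zpow_add]; rfl
      _ = B ^ (-1 : ℤ) := by rw [h, one_mul]
  · calc B ^ (-1 : ℤ) * B ^ (-1 : ℤ) = (B ^ (3 : ℤ))⁻¹ * B ^ (1 : ℤ) := by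
          simp only [← zpow_neg, ← zpow_add]; rfl
      _ = B ^ (1 : ℤ) := by rw [h, inv_one, one_mul]

lemma B_zpow_mul_of_ne {e f : ℤˣ} (h : e ≠ f) : B ^ (e : ℤ) * B ^ (f : ℤ) = 1 := by
  simp [Int.units_ne_iff_eq_neg.mp h]

lemma closure_A_B : Subgroup.closure {A, B} = (⊤ : Subgroup PSL2Z) := by
  have hA : A ∈ Subgroup.closure {A, B} := Subgroup.subset_closure (by simp)
  have hB : B ∈ Subgroup.closure {A, B} := Subgroup.subset_closure (by simp)
  have hT : proj ModularGroup.T = B * A := by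
    rw [A, B, ← map_mul, proj_eq_proj_iff]
    exact Or.inr (by decide)
  rw [eq_top_iff, ← Subgroup.map_top_of_surjective proj proj_surjective,
    ← SpecialLinearGroup.SL2Z_generators, MonoidHom.map_closure, Subgroup.closure_le]
  rintro _ ⟨x, rfl | rfl, rfl⟩
  · exact hA
  · exact hT ▸ mul_mem hB hA

/-- A word in the generators `A`, `B`, `B⁻¹`, as in the definition of `elementLength`. -/
def IsGeneratorWord (w : List PSL2Z) : Prop :=
  ∀ s ∈ w, s = A ∨ s = B ∨ s = B⁻¹

lemma isGeneratorWord_cons_iff {s : PSL2Z} {w : List PSL2Z} :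
    IsGeneratorWord (s :: w) ↔ (s = A ∨ ∃ e : ℤˣ, s = B ^ (e : ℤ)) ∧ IsGeneratorWord w := by
  have hB : (∃ e : ℤˣ, s = B ^ (e : ℤ)) ↔ s = B ∨ s = B⁻¹ := by
    constructor
    · rintro ⟨e, rfl⟩
      rcases Int.units_eq_one_or e with rfl | rfl <;> simp
    · rintro (rfl | rfl)
      exacts [⟨1, by simp⟩, ⟨-1, by simp⟩]
  rw [IsGeneratorWord, List.forall_mem_cons, hB, IsGeneratorWord]

lemma exists_isGeneratorWord (g : PSL2Z) : ∃ w, IsGeneratorWord w ∧ w.prod = g := by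
  have hg : g ∈ (Subgroup.closure {A, B}).toSubmonoid := by simp [closure_A_B]
  rw [Subgroup.closure_toSubmonoid] at hg
  obtain ⟨w, hw, rfl⟩ := Submonoid.exists_list_of_mem_closure hg
  refine ⟨w, fun s hs => ?_, rfl⟩
  have := hw s hs
  simp only [Set.inv_insert, Set.inv_singleton, A_inv, Set.mem_union, Set.mem_insert_iff,
    Set.mem_singleton_iff] at this
  tauto

/-! ### Matrices of sign words -/

/-- A matrix representing `A * B ^ e`; the sign is chosen to make the diagonal positive. -/
def signMat (e : ℤˣ) : SL(2, ℤ) :=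
  if e = 1 then ⟨!![1, 0; -1, 1], by simp⟩ else ⟨!![1, -1; 0, 1], by simp⟩

/-- A matrix representing `signWord l`; all its diagonal entries are positive. -/
def wordMat (l : List ℤˣ) : SL(2, ℤ) :=
  (l.map signMat).prod

lemma proj_signMat (e : ℤˣ) : proj (signMat e) = A * B ^ (e : ℤ) := by
  rw [A, B, ← map_zpow, ← map_mul, proj_eq_proj_iff]
  revert e
  decide

lemma signWord_eq_prod (l : List ℤˣ) :
    signWord l = (l.map fun e : ℤˣ => A * B ^ (e : ℤ)).prod := by
  -- In the definition of `signWord`, `l` is coerced to `List ℤ` through the list monad.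
  have hcoe : (do let a ← l; pure (a : ℤ) : List ℤ) = l.map fun e : ℤˣ => (e : ℤ) := by
    induction l <;> simp_all
  rw [signWord, hcoe, List.map_map]
  rfl

lemma signWord_nil : signWord [] = 1 := rfl

lemma signWord_cons (e : ℤˣ) (l : List ℤˣ) :
    signWord (e :: l) = A * B ^ (e : ℤ) * signWord l := by
  simp [signWord_eq_prod]

lemma signWord_singleton (e : ℤˣ) : signWord [e] = A * B ^ (e : ℤ) := by
  rw [signWord_cons, signWord_nil, mul_one]

lemma signWord_append (l m : List ℤˣ) : signWord (l ++ m) = signWord l * signWord m := by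
  simp [signWord_eq_prod]

lemma proj_wordMat (l : List ℤˣ) : proj (wordMat l) = signWord l := by
  simp [wordMat, signWord_eq_prod, map_list_prod, Function.comp_def, proj_signMat]

lemma wordMat_nil : wordMat [] = 1 := rfl

lemma wordMat_append (l m : List ℤˣ) : wordMat (l ++ m) = wordMat l * wordMat m := by
  simp [wordMat]

lemma wordMat_cons_one (l : List ℤˣ) :
    (wordMat (1 :: l)).1 = !![wordMat l 0 0, wordMat l 0 1;
      wordMat l 1 0 - wordMat l 0 0, wordMat l 1 1 - wordMat l 0 1] := by
  have h : wordMat (1 :: l) = signMat 1 * wordMat l := by simp [wordMat]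
  rw [h, Matrix.SpecialLinearGroup.coe_mul, Matrix.eta_fin_two (wordMat l).1]
  simp [signMat, neg_add_eq_sub]

lemma wordMat_cons_neg_one (l : List ℤˣ) :
    (wordMat (-1 :: l)).1 = !![wordMat l 0 0 - wordMat l 1 0, wordMat l 0 1 - wordMat l 1 1;
      wordMat l 1 0, wordMat l 1 1] := by
  have h : wordMat (-1 :: l) = signMat (-1) * wordMat l := by simp [wordMat]
  rw [h, Matrix.SpecialLinearGroup.coe_mul, Matrix.eta_fin_two (wordMat l).1]
  simp [signMat, ← sub_eq_add_neg, show (-1 : ℤˣ) ≠ 1 by decide]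

lemma wordMat_bounds (l : List ℤˣ) :
    1 ≤ wordMat l 0 0 ∧ wordMat l 0 1 ≤ 0 ∧ wordMat l 1 0 ≤ 0 ∧ 1 ≤ wordMat l 1 1 := by
  induction l with
  | nil => simp [wordMat_nil]
  | cons e l ih =>
    rcases Int.units_eq_one_or e with rfl | rfl
    · simp only [wordMat_cons_one, Matrix.of_apply, Matrix.cons_val]
      omega
    · simp only [wordMat_cons_neg_one, Matrix.of_apply, Matrix.cons_val]
      omega

lemma wordMat_cons_one_columns (l : List ℤˣ) :
    wordMat (1 :: l) 0 0 + wordMat (1 :: l) 1 0 ≤ 0 ∧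
      0 < wordMat (1 :: l) 0 1 + wordMat (1 :: l) 1 1 := by
  have := wordMat_bounds l
  simp only [wordMat_cons_one, Matrix.of_apply, Matrix.cons_val]
  omega

lemma wordMat_cons_neg_one_columns (l : List ℤˣ) :
    0 < wordMat (-1 :: l) 0 0 + wordMat (-1 :: l) 1 0 ∧
      wordMat (-1 :: l) 0 1 + wordMat (-1 :: l) 1 1 ≤ 0 := by
  have := wordMat_bounds l
  simp only [wordMat_cons_neg_one, Matrix.of_apply, Matrix.cons_val]
  omega

lemma wordMat_cons_ne_one (e : ℤˣ) (l : List ℤˣ) : wordMat (e :: l) ≠ 1 := by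
  intro h
  rcases Int.units_eq_one_or e with rfl | rfl
  · simpa [h] using (wordMat_cons_one_columns l).1
  · simpa [h] using (wordMat_cons_neg_one_columns l).2

lemma head_eq_of_wordMat_eq {e f : ℤˣ} {l m : List ℤˣ} (h : wordMat (e :: l) = wordMat (f :: m)) :
    e = f := by
  rcases Int.units_eq_one_or e with rfl | rfl <;> rcases Int.units_eq_one_or f with rfl | rfl
  · rfl
  · exact absurd (wordMat_cons_one_columns l).1 (h ▸ (wordMat_cons_neg_one_columns m).1).not_ge
  · exact absurd (wordMat_cons_one_columns m).1 (h ▸ (wordMat_cons_neg_one_columns l).1).not_ge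
  · rfl

lemma wordMat_injective : Function.Injective wordMat := by
  intro l
  induction l with
  | nil =>
    rintro (_ | ⟨f, m⟩) h
    · rfl
    · exact absurd h.symm (wordMat_cons_ne_one f m)
  | cons e l ih =>
    rintro (_ | ⟨f, m⟩) h
    · exact absurd h (wordMat_cons_ne_one e l)
    · obtain rfl := head_eq_of_wordMat_eq h
      rw [ih (mul_left_cancel (a := signMat e) (by simpa [wordMat] using h))]

lemma signWord_injective : Function.Injective signWord := by
  intro l m h
  rw [← proj_wordMat, ← proj_wordMat, proj_eq_proj_iff] at h
  refine wordMat_injective (h.resolve_right fun hneg => ?_)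
  have hl := (wordMat_bounds l).1
  have hm := (wordMat_bounds m).1
  have h00 : wordMat l 0 0 = -wordMat m 0 0 := by rw [hneg]; simp
  omega

lemma signWord_eq_one_iff {l : List ℤˣ} : signWord l = 1 ↔ l = [] :=
  signWord_injective.eq_iff' signWord_nil

/-! ### Reversing and negating a sign sequence -/

/-- The sequence `-εₖ, …, -ε₁`. Conjugation by `A` sends the inverse of a sign word to the sign
word of this sequence. -/
def negReverse (l : List ℤˣ) : List ℤˣ :=
  (l.map Neg.neg).reverse

lemma length_negReverse (l : List ℤˣ) : (negReverse l).length = l.length := by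
  simp [negReverse]

lemma negReverse_nil : negReverse [] = [] := rfl

lemma negReverse_cons (e : ℤˣ) (l : List ℤˣ) : negReverse (e :: l) = negReverse l ++ [-e] := by
  simp [negReverse]

lemma negReverse_append (l m : List ℤˣ) :
    negReverse (l ++ m) = negReverse m ++ negReverse l := by
  simp [negReverse]

lemma negReverse_involutive : Function.Involutive negReverse := by
  intro l
  simp [negReverse]

lemma negReverse_append_self (l : List ℤˣ) :
    negReverse (l ++ negReverse l) = l ++ negReverse l := by
  rw [negReverse_append, negReverse_involutive]

lemma wordMat_negReverse (l : List ℤˣ) : wordMat (negReverse l) = (wordMat l).transpose := by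
  have hsign (e : ℤˣ) : signMat (-e) = (signMat e).transpose := by
    revert e
    decide
  induction l with
  | nil => exact Subtype.ext Matrix.transpose_one.symm
  | cons e l ih =>
    apply Subtype.ext
    rw [negReverse_cons, wordMat_append, ih, show wordMat [-e] = signMat (-e) by simp [wordMat],
      show wordMat (e :: l) = signMat e * wordMat l by simp [wordMat], hsign]
    exact (Matrix.transpose_mul (signMat e).1 (wordMat l).1).symm

lemma A_mul_signWord_mul_A (l : List ℤˣ) :
    A * signWord l * A = (signWord (negReverse l))⁻¹ := by
  induction l with
  | nil => simp [signWord_nil, negReverse_nil, A_mul_A]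
  | cons e l ih =>
    have hA : signWord l = A * (signWord (negReverse l))⁻¹ * A := by
      rw [← ih]
      simp [mul_assoc, A_mul_A_mul, A_mul_A]
    rw [signWord_cons, negReverse_cons, signWord_append, signWord_singleton, hA]
    simp [mul_assoc, A_mul_A_mul, A_mul_A, A_inv]

lemma eq_nil_of_A_mul_signWord_mul_A_eq {l m : List ℤˣ} (h : A * signWord l * A = signWord m) :
    l = [] := by
  have hone : signWord (negReverse l ++ m) = 1 := by
    rw [signWord_append, ← h, A_mul_signWord_mul_A, mul_inv_cancel]
  have hnil := signWord_eq_one_iff.mp hone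
  rw [List.append_eq_nil_iff, ← List.length_eq_zero_iff, length_negReverse] at hnil
  exact List.length_eq_zero_iff.mp hnil.1

/-! ### Normal forms and conjugacy classes -/

/-- `g = A ^ a * (A * B ^ ε₁) ⋯ (A * B ^ εₖ) * A ^ b` with `a, b ≤ 1`, and this expression has at
most `n` letters once the two leading letters `A` of the case `a = 1` have been cancelled. -/
def HasNormalForm (n : ℕ) (g : PSL2Z) : Prop :=
  ∃ (a b : ℕ) (l : List ℤˣ), a ≤ 1 ∧ b ≤ 1 ∧ (l = [] → a = 0) ∧
    g = A ^ a * signWord l * A ^ b ∧ 2 * l.length + b ≤ n + a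

lemma HasNormalForm.A_mul {n : ℕ} {g : PSL2Z} (h : HasNormalForm n g) :
    HasNormalForm (n + 1) (A * g) := by
  obtain ⟨a, b, l, ha, hb, hl, rfl, hn⟩ := h
  rcases Nat.le_one_iff_eq_zero_or_eq_one.mp ha with rfl | rfl
  · rcases eq_or_ne l [] with rfl | hl'
    · refine ⟨0, 1 - b, [], by omega, by omega, by simp, ?_, by rw [List.length_nil]; omega⟩
      rcases Nat.le_one_iff_eq_zero_or_eq_one.mp hb with rfl | rfl <;>
        simp [signWord_nil, A_mul_A]
    · exact ⟨1, b, l, le_rfl, hb, fun h => absurd h hl', by simp [mul_assoc], by omega⟩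
  · exact ⟨0, b, l, by omega, hb, by simp, by simp [mul_assoc, A_mul_A_mul], by omega⟩

lemma HasNormalForm.B_zpow_mul {n : ℕ} {g : PSL2Z} (h : HasNormalForm n g) (f : ℤˣ) :
    HasNormalForm (n + 1) (B ^ (f : ℤ) * g) := by
  obtain ⟨a, b, l, ha, hb, hl, rfl, hn⟩ := h
  rcases Nat.le_one_iff_eq_zero_or_eq_one.mp ha with rfl | rfl
  · refine ⟨1, b, f :: l, le_rfl, hb, by simp, ?_, by simp only [List.length_cons]; omega⟩
    simp [signWord_cons, mul_assoc, A_mul_A_mul]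
  · obtain ⟨e, l, rfl⟩ := List.exists_cons_of_ne_nil fun h => one_ne_zero (hl h)
    simp only [List.length_cons] at hn
    by_cases hfe : f = e
    · subst hfe
      refine ⟨1, b, -f :: l, le_rfl, hb, by simp, ?_, by simp only [List.length_cons]; omega⟩
      simp only [signWord_cons, pow_one, mul_assoc, A_mul_A_mul, ← B_zpow_mul_self]
    · refine ⟨0, b, l, by omega, hb, by simp, ?_, by omega⟩
      simp only [signWord_cons, pow_one, pow_zero, one_mul, mul_assoc, A_mul_A_mul]
      rw [← mul_assoc, B_zpow_mul_of_ne hfe, one_mul]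

lemma IsGeneratorWord.hasNormalForm {w : List PSL2Z} (hw : IsGeneratorWord w) :
    HasNormalForm w.length w.prod := by
  induction w with
  | nil => exact ⟨0, 0, [], by simp [signWord_nil]⟩
  | cons s w ih =>
    obtain ⟨rfl | ⟨e, rfl⟩, hw'⟩ := isGeneratorWord_cons_iff.mp hw
    · exact (ih hw').A_mul
    · exact (ih hw').B_zpow_mul e

lemma exists_normalForm (g : PSL2Z) :
    ∃ (a b : ℕ) (l : List ℤˣ), a ≤ 1 ∧ b ≤ 1 ∧ g = A ^ a * signWord l * A ^ b := by
  obtain ⟨w, hw, rfl⟩ := exists_isGeneratorWord g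
  obtain ⟨a, b, l, ha, hb, -, h, -⟩ := hw.hasNormalForm
  exact ⟨a, b, l, ha, hb, h⟩

lemma signWord_concat_mul_B_zpow_self (l : List ℤˣ) (e : ℤˣ) :
    signWord (l ++ [e]) * B ^ (e : ℤ) = signWord (l ++ [-e]) := by
  simp only [signWord_append, signWord_singleton, mul_assoc, B_zpow_mul_self]

lemma signWord_concat_mul_B_zpow_of_ne (l : List ℤˣ) {e f : ℤˣ} (h : e ≠ f) :
    signWord (l ++ [e]) * B ^ (f : ℤ) = signWord l * A := by
  rw [signWord_append, signWord_singleton, mul_assoc, mul_assoc, B_zpow_mul_of_ne h, mul_one]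

lemma mul_A_mul_signWord_cons (g : PSL2Z) (e : ℤˣ) (l : List ℤˣ) :
    g * A * signWord (e :: l) = g * B ^ (e : ℤ) * signWord l := by
  simp only [signWord_cons, mul_assoc, A_mul_A_mul]

lemma exists_signWord_mul_A_mul_signWord_eq {l m : List ℤˣ} (h : m.length ≤ l.length) :
    ∃ (p : List ℤˣ) (b : ℕ), signWord l * A * signWord m = signWord p * A ^ b := by
  induction m generalizing l with
  | nil => exact ⟨l, 1, by rw [signWord_nil, mul_one, pow_one]⟩
  | cons e m ih =>
    obtain ⟨l, f, rfl⟩ := (List.eq_nil_or_concat' l).resolve_left (by rintro rfl; simp at h)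
    rw [mul_A_mul_signWord_cons]
    by_cases hfe : f = e
    · subst hfe
      refine ⟨l ++ [-f] ++ m, 0, ?_⟩
      rw [signWord_concat_mul_B_zpow_self, ← signWord_append, pow_zero, mul_one]
    · rw [signWord_concat_mul_B_zpow_of_ne l hfe]
      exact ih (by simpa using h)

lemma exists_signWord_pow_mul_eq {l : List ℤˣ} (hl : l ≠ []) (g : PSL2Z) :
    ∃ (n : ℕ) (p : List ℤˣ) (b : ℕ), signWord l ^ n * g = signWord p * A ^ b := by
  have hpow (n : ℕ) : signWord l ^ n = signWord (List.replicate n l).flatten := by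
    induction n with
    | zero => rw [pow_zero, List.replicate_zero, List.flatten_nil, signWord_nil]
    | succ n ih => rw [pow_succ', ih, List.replicate_succ, List.flatten_cons, signWord_append]
  obtain ⟨a, b, m, ha, -, rfl⟩ := exists_normalForm g
  rcases Nat.le_one_iff_eq_zero_or_eq_one.mp ha with rfl | rfl
  · exact ⟨0, m, b, by simp⟩
  · have hlen : m.length ≤ (List.replicate m.length l).flatten.length := by
      simpa using Nat.le_mul_of_pos_right _ (List.length_pos_iff.mpr hl)
    obtain ⟨p, c, hp⟩ := exists_signWord_mul_A_mul_signWord_eq hlen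
    refine ⟨m.length, p, c + b, ?_⟩
    rw [pow_add, ← mul_assoc (signWord p), ← hp, hpow, pow_one, ← mul_assoc, ← mul_assoc]

lemma exists_eq_append_of_isRotated {α : Type*} {l l' : List α} (h : l ~r l') :
    ∃ a b, l = a ++ b ∧ l' = b ++ a := by
  obtain ⟨n, hn, rfl⟩ := List.isRotated_iff_mod.mp h
  exact ⟨l.take n, l.drop n, (List.take_append_drop n l).symm,
    List.rotate_eq_drop_append_take hn⟩

lemma isRotated_of_append_eq_append {α : Type*} {m l l' : List α} (h : m ++ l = l' ++ m) :
    l ~r l' := by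
  induction hn : m.length using Nat.strong_induction_on generalizing m with
  | _ n ih =>
    rcases List.append_eq_append_iff.mp h with ⟨r, rfl, rfl⟩ | ⟨r, rfl, hr⟩
    · exact List.isRotated_append
    · rcases eq_or_ne l' [] with rfl | hl'
      · simp_all
      · have := List.length_pos_iff.mpr hl'
        exact ih r.length (by rw [List.length_append] at hn; omega) hr.symm rfl

lemma isRotated_of_signWord_mul_A_mul_eq {m l l' : List ℤˣ} (hl : l ≠ [])
    (h : signWord m * A * signWord l = signWord l' * (signWord m * A)) : l ~r l' := by
  induction m using List.reverseRecOn generalizing l with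
  | nil =>
    rw [signWord_nil, one_mul] at h
    refine absurd (eq_nil_of_A_mul_signWord_mul_A_eq (m := l') ?_) hl
    rw [h, mul_assoc, A_mul_A, mul_one]
  | append_singleton m f ih =>
    obtain ⟨e, l, rfl⟩ := List.exists_cons_of_ne_nil hl
    by_cases hfe : f = e
    · subst hfe
      have hm : signWord (m ++ [f]) * A * signWord (f :: l) = signWord (m ++ [-f] ++ l) := by
        rw [mul_A_mul_signWord_cons, signWord_concat_mul_B_zpow_self, ← signWord_append]
      refine isRotated_of_append_eq_append (m := m ++ [-f] ++ l) (signWord_injective ?_)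
      rw [signWord_append, signWord_append l', ← hm, h, mul_assoc, h]
    · have hm (p : List ℤˣ) : signWord (m ++ [f]) * A * signWord (e :: p) =
          signWord m * A * signWord p := by
        rw [mul_A_mul_signWord_cons, signWord_concat_mul_B_zpow_of_ne m hfe]
      have hrot : l ++ [e] ~r l' := by
        refine ih (by simp) ?_
        calc signWord m * A * signWord (l ++ [e])
            = signWord (m ++ [f]) * A * signWord (e :: l) * signWord [e] := by
              rw [hm, signWord_append, mul_assoc (_ * A)]
          _ = signWord l' * (signWord (m ++ [f]) * A * signWord [e]) := by
              rw [h]; simp only [mul_assoc]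
          _ = signWord l' * (signWord m * A) := by rw [hm, signWord_nil, mul_one]
      exact (List.isRotated_append (l := [e])).trans hrot

theorem isRotated_of_isConj_signWord {l l' : List ℤˣ} (h : IsConj (signWord l) (signWord l')) :
    l ~r l' := by
  rcases eq_or_ne l' [] with rfl | hl'
  · rw [signWord_nil, isConj_one_left, signWord_eq_one_iff] at h
    rw [h]
  rcases eq_or_ne l [] with rfl | hl
  · rw [signWord_nil, isConj_one_right, signWord_eq_one_iff] at h
    exact absurd h hl'
  obtain ⟨g, hg⟩ := isConj_iff.mp h
  obtain ⟨n, m, b, hm⟩ := exists_signWord_pow_mul_eq hl' g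
  have hcomm : signWord m * A ^ b * signWord l = signWord l' * (signWord m * A ^ b) := by
    rw [mul_inv_eq_iff_eq_mul] at hg
    rw [← hm, mul_assoc, hg, ← mul_assoc, ← mul_assoc, ← pow_succ, pow_succ']
  have hb : A ^ b = 1 ∨ A ^ b = A := by
    have hsq : A ^ 2 = 1 := by rw [sq, A_mul_A]
    rcases Nat.even_or_odd' b with ⟨k, rfl | rfl⟩
    · exact Or.inl (by rw [pow_mul, hsq, one_pow])
    · exact Or.inr (by rw [pow_succ, pow_mul, hsq, one_pow, one_mul])
  rcases hb with hb | hb <;> rw [hb] at hcomm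
  · rw [mul_one, ← signWord_append, ← signWord_append] at hcomm
    exact isRotated_of_append_eq_append (signWord_injective hcomm)
  · exact isRotated_of_signWord_mul_A_mul_eq hl hcomm

lemma isConj_mul_comm {G : Type*} [Group G] (a b : G) : IsConj (a * b) (b * a) :=
  isConj_iff.mpr ⟨b, by group⟩

lemma isConj_signWord_of_isRotated {l l' : List ℤˣ} (h : l ~r l') :
    IsConj (signWord l) (signWord l') := by
  obtain ⟨a, b, rfl, rfl⟩ := exists_eq_append_of_isRotated h
  rw [signWord_append, signWord_append]
  exact isConj_mul_comm _ _

lemma abs_trace_eq_of_isConj_proj {X Y : SL(2, ℤ)} (h : IsConj (proj X) (proj Y)) :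
    |X.1.trace| = |Y.1.trace| := by
  obtain ⟨g, hg⟩ := isConj_iff.mp h
  obtain ⟨Z, rfl⟩ := proj_surjective g
  have htrace : (Z * X * Z⁻¹).1.trace = X.1.trace := by
    rw [Matrix.SpecialLinearGroup.coe_mul, Matrix.trace_mul_comm,
      ← Matrix.SpecialLinearGroup.coe_mul, ← mul_assoc, inv_mul_cancel, one_mul]
  rw [← map_inv, ← map_mul, ← map_mul, proj_eq_proj_iff] at hg
  rcases hg with hg | hg <;> rw [← htrace, hg]
  simp

lemma two_le_abs_trace_wordMat (l : List ℤˣ) : 2 ≤ |(wordMat l).1.trace| := by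
  have := wordMat_bounds l
  rw [Matrix.trace_fin_two]
  exact le_trans (by omega) (le_abs_self _)

lemma two_le_abs_trace_of_isConj_signWord {X : SL(2, ℤ)} {l : List ℤˣ}
    (h : IsConj (proj X) (signWord l)) : 2 ≤ |X.1.trace| := by
  rw [← proj_wordMat] at h
  exact abs_trace_eq_of_isConj_proj h ▸ two_le_abs_trace_wordMat l

lemma not_isConj_A_signWord (l : List ℤˣ) : ¬ IsConj A (signWord l) := fun h =>
  absurd (two_le_abs_trace_of_isConj_signWord h) (by decide)

lemma not_isConj_B_zpow_signWord (e : ℤˣ) (l : List ℤˣ) :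
    ¬ IsConj (B ^ (e : ℤ)) (signWord l) := by
  intro h
  rw [B, ← map_zpow] at h
  have := two_le_abs_trace_of_isConj_signWord h
  clear h
  revert e
  decide

lemma isConj_signWord_mul_A (l : List ℤˣ) :
    IsConj (signWord l * A) A ∨ (∃ e : ℤˣ, IsConj (signWord l * A) (B ^ (e : ℤ))) ∨
      ∃ m, m.length < l.length ∧ IsConj (signWord l * A) (signWord m) := by
  induction l using List.bidirectionalRec with
  | nil => exact Or.inl (by rw [signWord_nil, one_mul])
  | singleton e =>
    refine Or.inr (Or.inl ⟨e, ?_⟩)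
    rw [signWord_singleton, mul_assoc]
    simpa [mul_assoc, A_mul_A] using isConj_mul_comm A (B ^ (e : ℤ) * A)
  | cons_append e l f ih =>
    have hconj : IsConj (signWord (e :: (l ++ [f])) * A) (signWord (l ++ [f]) * B ^ (e : ℤ)) := by
      have hA := isConj_mul_comm (signWord (e :: (l ++ [f]))) A
      rw [signWord_cons, mul_assoc A, A_mul_A_mul] at hA
      rw [signWord_cons, mul_assoc A]
      exact hA.trans (isConj_mul_comm _ _)
    by_cases hfe : f = e
    · subst hfe
      rw [signWord_concat_mul_B_zpow_self] at hconj
      exact Or.inr (Or.inr ⟨l ++ [-f], by simp, hconj⟩)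
    · rw [signWord_concat_mul_B_zpow_of_ne l hfe] at hconj
      refine ih.imp hconj.trans (Or.imp ?_ ?_)
      · exact fun ⟨e', h⟩ => ⟨e', hconj.trans h⟩
      · exact fun ⟨m, hm, h⟩ => ⟨m, by simp; omega, hconj.trans h⟩

lemma IsGeneratorWord.isConj_prod {w : List PSL2Z} (hw : IsGeneratorWord w) :
    IsConj w.prod A ∨ (∃ e : ℤˣ, IsConj w.prod (B ^ (e : ℤ))) ∨
      ∃ m, 2 * m.length ≤ w.length ∧ IsConj w.prod (signWord m) := by
  obtain ⟨a, b, l, ha, hb, -, hprod, hlen⟩ := hw.hasNormalForm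
  have hconj : IsConj w.prod (signWord l * A ^ (a + b)) := by
    rw [hprod, mul_assoc, add_comm, pow_add, ← mul_assoc (signWord l)]
    exact isConj_mul_comm _ _
  by_cases hab : a = b
  · rw [hab, ← two_mul, pow_mul, sq, A_mul_A, one_pow, mul_one] at hconj
    exact Or.inr (Or.inr ⟨l, by omega, hconj⟩)
  · rw [show a + b = 1 by omega, pow_one] at hconj
    refine (isConj_signWord_mul_A l).imp hconj.trans (Or.imp ?_ ?_)
    · exact fun ⟨e, h⟩ => ⟨e, hconj.trans h⟩
    · exact fun ⟨m, hm, h⟩ => ⟨m, by omega, hconj.trans h⟩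

lemma isConj_A_of_trace_eq_zero {X : SL(2, ℤ)} (hX : X.1.trace = 0) : IsConj (proj X) A := by
  obtain ⟨w, hw, hprod⟩ := exists_isGeneratorWord (proj X)
  rcases hprod ▸ hw.isConj_prod with h | ⟨e, h⟩ | ⟨m, -, h⟩
  · exact h
  · rw [B, ← map_zpow] at h
    have htrace := abs_trace_eq_of_isConj_proj h
    rw [hX] at htrace
    exfalso
    clear h
    revert e htrace
    decide
  · have htrace := two_le_abs_trace_of_isConj_signWord h
    norm_num [hX] at htrace

lemma isConj_A_of_orderOf_eq_two {g : PSL2Z} (hg : orderOf g = 2) : IsConj g A := by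
  have hg1 : g ≠ 1 := by rintro rfl; simp at hg
  have hg2 : g ^ 2 = 1 := orderOf_dvd_iff_pow_eq_one.mp hg.dvd
  have hsq {x : PSL2Z} (h : IsConj g x) : x ≠ 1 ∧ x ^ 2 = 1 := by
    refine ⟨fun hx => hg1 (isConj_one_left.mp (hx ▸ h)), isConj_one_right.mp ?_⟩
    rw [← hg2]
    exact h.pow 2
  obtain ⟨w, hw, rfl⟩ := exists_isGeneratorWord g
  rcases hw.isConj_prod with h | ⟨e, h⟩ | ⟨m, -, h⟩
  · exact h
  · have hcube : (B ^ (e : ℤ)) ^ 3 = 1 := by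
      rw [← zpow_natCast, ← zpow_mul, mul_comm, zpow_mul, zpow_natCast, B_pow_three, one_zpow]
    obtain ⟨h1, h2⟩ := hsq h
    rw [pow_succ, h2, one_mul] at hcube
    exact absurd hcube h1
  · obtain ⟨h1, h2⟩ := hsq h
    rw [sq, ← signWord_append, signWord_eq_one_iff, List.append_eq_nil_iff] at h2
    exact absurd (signWord_eq_one_iff.mpr h2.1) h1

lemma orderOf_A : orderOf A = 2 := by
  refine orderOf_eq_prime (by rw [sq, A_mul_A]) fun h => ?_
  rw [A, ← map_one proj, proj_eq_proj_iff] at h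
  revert h
  decide

/-! ### Word length -/

lemma exists_isGeneratorWord_signWord (l : List ℤˣ) :
    ∃ w, IsGeneratorWord w ∧ w.prod = signWord l ∧ w.length = 2 * l.length := by
  induction l with
  | nil => exact ⟨[], by simp [IsGeneratorWord, signWord_nil]⟩
  | cons e l ih =>
    obtain ⟨w, hw, hprod, hlen⟩ := ih
    refine ⟨A :: B ^ (e : ℤ) :: w, ?_, ?_, by simp only [List.length_cons, hlen]; ring⟩
    · exact isGeneratorWord_cons_iff.mpr
        ⟨Or.inl rfl, isGeneratorWord_cons_iff.mpr ⟨Or.inr ⟨e, rfl⟩, hw⟩⟩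
    · rw [List.prod_cons, List.prod_cons, hprod, signWord_cons, mul_assoc]

lemma two_mul_length_le_of_isConj {l : List ℤˣ} {w : List PSL2Z} (hw : IsGeneratorWord w)
    (h : IsConj (signWord l) w.prod) : 2 * l.length ≤ w.length := by
  rcases hw.isConj_prod with hA | ⟨e, hB⟩ | ⟨m, hm, hm'⟩
  · exact absurd (h.trans hA).symm (not_isConj_A_signWord l)
  · exact absurd (h.trans hB).symm (not_isConj_B_zpow_signWord e l)
  · rwa [(isRotated_of_isConj_signWord (h.trans hm')).perm.length_eq]

theorem wordLength_mk_signWord (l : List ℤˣ) :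
    wordLength (ConjClasses.mk (signWord l)) = 2 * l.length := by
  apply le_antisymm
  · obtain ⟨w, hw, hprod, hlen⟩ := exists_isGeneratorWord_signWord l
    exact le_trans (Nat.sInf_le ⟨signWord l, rfl, rfl⟩) (Nat.sInf_le ⟨w, hw, hprod, hlen⟩)
  · refine le_csInf ⟨_, signWord l, rfl, rfl⟩ ?_
    rintro _ ⟨g, hg, rfl⟩
    obtain ⟨w₀, hw₀, hprod₀⟩ := exists_isGeneratorWord g
    refine le_csInf ⟨_, w₀, hw₀, hprod₀, rfl⟩ ?_
    rintro _ ⟨w, hw, rfl, rfl⟩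
    exact two_mul_length_le_of_isConj hw (ConjClasses.mk_eq_mk_iff_isConj.mp hg).symm

/-! ### The axis of a hyperbolic matrix -/

/-- The numerator of `z - h • z`, as a quadratic polynomial in `z`. -/
noncomputable def fixedPointForm (h : SL(2, ℤ)) (z : ℂ) : ℂ :=
  h 1 0 * z ^ 2 + (h 1 1 - h 0 0) * z - h 0 1

/-- The polarization of `fixedPointForm h` at `z` and its complex conjugate. For hyperbolic `h` it
vanishes exactly on the geodesic joining the two real fixed points of `h`. -/
noncomputable def axisForm (h : SL(2, ℤ)) (z : UpperHalfPlane) : ℝ :=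
  h 1 0 * (z.re ^ 2 + z.im ^ 2) + (h 1 1 - h 0 0) * z.re - h 0 1

lemma det_entries (h : SL(2, ℤ)) : h 0 0 * h 1 1 - h 0 1 * h 1 0 = 1 := by
  rw [← Matrix.det_fin_two, h.det_coe]

lemma coe_sub_coe_smul (h : SL(2, ℤ)) (z : UpperHalfPlane) :
    (z : ℂ) - (h • z : UpperHalfPlane) = fixedPointForm h z / UpperHalfPlane.denom h z := by
  have hd := UpperHalfPlane.denom_ne_zero h z
  rw [ModularGroup.denom_apply] at hd ⊢
  rw [UpperHalfPlane.coe_specialLinearGroup_apply, fixedPointForm]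
  simp only [algebraMap_int_eq, eq_intCast, Complex.ofReal_intCast]
  rw [sub_eq_iff_eq_add, ← add_div, eq_div_iff hd]
  ring

lemma normSq_fixedPointForm (h : SL(2, ℤ)) (z : UpperHalfPlane) :
    Complex.normSq (fixedPointForm h z) =
      axisForm h z ^ 2 + ((h 0 0 + h 1 1 : ℝ) ^ 2 - 4) * z.im ^ 2 := by
  have hdet : (h 0 0 : ℝ) * h 1 1 - h 0 1 * h 1 0 = 1 := mod_cast det_entries h
  rw [Complex.normSq_apply, axisForm, fixedPointForm]
  simp only [pow_two, Complex.sub_re, Complex.add_re, Complex.mul_re, Complex.intCast_re,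
    UpperHalfPlane.coe_re, UpperHalfPlane.coe_im, Complex.intCast_im, Complex.mul_im, zero_mul,
    sub_zero, Complex.sub_im, sub_self, Complex.add_im, add_zero]
  linear_combination (-4 * (z.im) ^ 2) * hdet

lemma cosh_dist_smul (h : SL(2, ℤ)) (z : UpperHalfPlane) :
    Real.cosh (dist z (h • z)) =
      1 + ((axisForm h z / z.im) ^ 2 + ((h 0 0 + h 1 1 : ℝ) ^ 2 - 4)) / 2 := by
  have hn := UpperHalfPlane.normSq_denom_ne_zero h z.im_ne_zero
  rw [UpperHalfPlane.cosh_dist, Complex.dist_eq, ← Complex.normSq_eq_norm_sq, coe_sub_coe_smul,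
    Complex.normSq_div, normSq_fixedPointForm, ModularGroup.im_smul_eq_div_normSq]
  field_simp

lemma smul_eq_self_iff (h : SL(2, ℤ)) (z : UpperHalfPlane) :
    h • z = z ↔ fixedPointForm h z = 0 := by
  rw [eq_comm, UpperHalfPlane.ext_iff, ← sub_eq_zero, coe_sub_coe_smul, div_eq_zero_iff,
    or_iff_left (UpperHalfPlane.denom_ne_zero h z)]

lemma exists_axisForm_eq_zero {h : SL(2, ℤ)} (hh : IsHyperbolic h) : ∃ z, axisForm h z = 0 := by
  have hdet := det_entries h
  have htr : 4 < (h 0 0 + h 1 1) ^ 2 := by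
    rw [IsHyperbolic, Matrix.trace_fin_two] at hh
    rw [← sq_abs]
    nlinarith
  have hc : h 1 0 ≠ 0 := by
    intro hc
    rw [hc, mul_zero, sub_zero] at hdet
    rcases Int.mul_eq_one_iff_eq_one_or_neg_one.mp hdet with ⟨h1, h2⟩ | ⟨h1, h2⟩ <;>
      norm_num [h1, h2] at htr
  have hc' : (h 1 0 : ℝ) ≠ 0 := mod_cast hc
  have hdet' : (h 0 0 : ℝ) * h 1 1 - h 0 1 * h 1 0 = 1 := mod_cast hdet
  -- The top of the half circle joining the two fixed points.
  have hy : 0 < ((h 0 0 + h 1 1 : ℝ) ^ 2 - 4) / (4 * h 1 0 ^ 2) := by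
    have : (4 : ℝ) < (h 0 0 + h 1 1) ^ 2 := mod_cast htr
    have : 0 < ((h 0 0 + h 1 1 : ℝ) ^ 2 - 4) := by linarith
    positivity
  refine ⟨⟨⟨(h 0 0 - h 1 1) / (2 * h 1 0), √(((h 0 0 + h 1 1 : ℝ) ^ 2 - 4) / (4 * h 1 0 ^ 2))⟩,
    Real.sqrt_pos.mpr hy⟩, ?_⟩
  simp only [axisForm, UpperHalfPlane.re, UpperHalfPlane.im, Real.sq_sqrt hy.le]
  field_simp
  linear_combination 16 * hdet'

lemma mem_axis_iff {h : SL(2, ℤ)} (hh : IsHyperbolic h) (z : UpperHalfPlane) :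
    z ∈ axis h ↔ axisForm h z = 0 := by
  have hdist (w : UpperHalfPlane) : dist z (h • z) ≤ dist w (h • w) ↔
      (axisForm h z / z.im) ^ 2 ≤ (axisForm h w / w.im) ^ 2 := by
    rw [← abs_of_nonneg (dist_nonneg (x := z) (y := h • z)),
      ← abs_of_nonneg (dist_nonneg (x := w) (y := h • w)), ← Real.cosh_le_cosh, cosh_dist_smul,
      cosh_dist_smul]
    constructor <;> intro h <;> linarith
  simp only [axis, Set.mem_ofPred_eq, hdist]
  constructor
  · intro hz
    obtain ⟨w, hw⟩ := exists_axisForm_eq_zero hh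
    have hle := hz w
    rw [hw, zero_div, zero_pow two_ne_zero] at hle
    have hdiv := pow_eq_zero_iff two_ne_zero |>.mp (le_antisymm hle (sq_nonneg _))
    exact (div_eq_zero_iff.mp hdiv).resolve_right z.im_ne_zero
  · intro hz w
    rw [hz, zero_div, zero_pow two_ne_zero]
    positivity

/-! ### Reciprocal classes -/

lemma eq_of_smul_eq_self_of_trace_eq_zero {k : SL(2, ℤ)} {z : UpperHalfPlane}
    (hk : k.1.trace = 0) (hz : k • z = z) :
    (k 1 0 : ℝ) * z.re = k 0 0 ∧ (k 1 0 : ℝ) * (z.re ^ 2 + z.im ^ 2) = -k 0 1 := by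
  have hk' : (k 0 0 + k 1 1 : ℝ) = 0 := by rw [Matrix.trace_fin_two] at hk; exact_mod_cast hk
  rw [smul_eq_self_iff, Complex.ext_iff] at hz
  obtain ⟨hre, him⟩ := hz
  simp only [fixedPointForm, pow_two, Complex.sub_re, Complex.add_re, Complex.mul_re,
    Complex.sub_im, Complex.add_im, Complex.mul_im, Complex.intCast_re, Complex.intCast_im,
    Complex.zero_re, Complex.zero_im, UpperHalfPlane.coe_re, UpperHalfPlane.coe_im] at hre him
  have hx : (k 1 0 : ℝ) * z.re = k 0 0 := by
    refine mul_left_cancel₀ (mul_ne_zero two_ne_zero z.im_ne_zero) ?_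
    linear_combination him - z.im * hk'
  exact ⟨hx, by linear_combination -hre + z.re * hk' + 2 * z.re * hx⟩

lemma trace_mul_eq_zero {h k : SL(2, ℤ)} {z : UpperHalfPlane} (hz : axisForm h z = 0)
    (hk : k.1.trace = 0) (hkz : k • z = z) : (h * k).1.trace = 0 := by
  obtain ⟨hx, hn⟩ := eq_of_smul_eq_self_of_trace_eq_zero hk hkz
  have hk' : (k 0 0 + k 1 1 : ℝ) = 0 := by rw [Matrix.trace_fin_two] at hk; exact_mod_cast hk
  rw [axisForm] at hz
  have htrace : (h 0 0 * k 0 0 + h 0 1 * k 1 0 + (h 1 0 * k 0 1 + h 1 1 * k 1 1) : ℝ) = 0 := by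
    linear_combination (-(k 1 0 : ℝ)) * hz + (h 1 0 : ℝ) * hn + ((h 1 1 : ℝ) - h 0 0) * hx
      + (h 1 1 : ℝ) * hk'
  rw [Matrix.SpecialLinearGroup.coe_mul, Matrix.trace_fin_two, Matrix.mul_apply,
    Matrix.mul_apply, Fin.sum_univ_two, Fin.sum_univ_two]
  exact_mod_cast htrace

lemma signWord_append_negReverse (l : List ℤˣ) :
    signWord (l ++ negReverse l) = signWord l * A * (signWord l)⁻¹ * A := by
  have hl := congrArg (fun g => g⁻¹) (A_mul_signWord_mul_A l)
  simp only [mul_inv_rev, A_inv, inv_inv] at hl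
  rw [signWord_append, ← hl]
  simp only [mul_assoc]

lemma exists_isConj_signWord_append_negReverse (g : PSL2Z) :
    ∃ l, IsConj (g * A * g⁻¹ * A) (signWord (l ++ negReverse l)) := by
  obtain ⟨a, b, l, -, -, rfl⟩ := exists_normalForm g
  refine ⟨l, isConj_iff.mpr ⟨(A ^ a)⁻¹, ?_⟩⟩
  have hb : A ^ b * A * (A ^ b)⁻¹ = A := by
    rw [← pow_succ, pow_succ', mul_assoc, mul_inv_cancel, mul_one]
  have ha : A * A ^ a = A ^ a * A := by rw [← pow_succ, pow_succ']
  rw [signWord_append_negReverse]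
  calc (A ^ a)⁻¹ * (A ^ a * signWord l * A ^ b * A * (A ^ a * signWord l * A ^ b)⁻¹ * A) *
        (A ^ a)⁻¹⁻¹
      = signWord l * (A ^ b * A * (A ^ b)⁻¹) * (signWord l)⁻¹ * ((A ^ a)⁻¹ * (A * A ^ a)) := by
        group
    _ = signWord l * A * (signWord l)⁻¹ * A := by rw [hb, ha, inv_mul_cancel_left]

lemma wordMat_append_negReverse_symm (l : List ℤˣ) :
    wordMat (l ++ negReverse l) 0 1 = wordMat (l ++ negReverse l) 1 0 := by
  nth_rw 1 [← negReverse_append_self, wordMat_negReverse]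
  rfl

lemma isHyperbolic_wordMat_append_negReverse {l : List ℤˣ} (hl : l ≠ []) :
    IsHyperbolic (wordMat (l ++ negReverse l)) := by
  obtain ⟨h00, -, -, h11⟩ := wordMat_bounds (l ++ negReverse l)
  have hdet := det_entries (wordMat (l ++ negReverse l))
  have hsymm := wordMat_append_negReverse_symm l
  rw [IsHyperbolic, Matrix.trace_fin_two]
  refine lt_of_lt_of_le ?_ (le_abs_self _)
  by_contra! hle
  have h00' : wordMat (l ++ negReverse l) 0 0 = 1 := by omega
  have h11' : wordMat (l ++ negReverse l) 1 1 = 1 := by omega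
  rw [h00', h11', ← hsymm] at hdet
  have h01 : wordMat (l ++ negReverse l) 0 1 = 0 := by nlinarith
  have hone : wordMat (l ++ negReverse l) = wordMat [] := by
    ext i j
    fin_cases i <;> fin_cases j <;> simp [wordMat_nil, h00', h11', h01, ← hsymm]
  have hnil := wordMat_injective hone
  exact hl (List.append_eq_nil_iff.mp hnil).1

/-- The conjugacy class of the sign word of the symmetric sequence `l ++ negReverse l`. For
nonempty `l` this sequence is a normal form of the class, which is reciprocal. -/
def reciprocalClass (l : List ℤˣ) : ConjClasses PSL2Z :=
  ConjClasses.mk (signWord (l ++ negReverse l))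

lemma exists_eq_reciprocalClass {c : ConjClasses PSL2Z} (hc : IsReciprocal c) :
    ∃ l, l ≠ [] ∧ c = reciprocalClass l := by
  obtain ⟨h, hh, rfl, z, hz, k, hk, hkz⟩ := hc
  have hkA := isConj_A_of_orderOf_eq_two hk
  have hk0 : k.1.trace = 0 := abs_eq_zero.mp ((abs_trace_eq_of_isConj_proj hkA).trans (by decide))
  have hhk := trace_mul_eq_zero ((mem_axis_iff hh z).mp hz) hk0 hkz
  obtain ⟨g₁, hg₁⟩ := isConj_iff.mp (isConj_A_of_trace_eq_zero hhk).symm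
  obtain ⟨g₂, hg₂⟩ := isConj_iff.mp hkA.symm
  obtain ⟨l, hl⟩ := exists_isConj_signWord_append_negReverse (g₂⁻¹ * g₁)
  have hprod : proj h = g₁ * A * g₁⁻¹ * (g₂ * A * g₂⁻¹) := by
    have hinv : g₂ * A * g₂⁻¹ = (g₂ * A * g₂⁻¹)⁻¹ := by simp [mul_assoc, A_inv]
    rw [hinv, hg₁, hg₂, map_mul, mul_inv_cancel_right]
  have hconj : IsConj (proj h) (signWord (l ++ negReverse l)) := by
    refine IsConj.trans (isConj_iff.mpr ⟨g₂⁻¹, ?_⟩) hl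
    rw [hprod]
    group
  refine ⟨l, ?_, ConjClasses.mk_eq_mk_iff_isConj.mpr hconj⟩
  rintro rfl
  rw [negReverse_nil, List.append_nil, ← proj_wordMat, wordMat_nil] at hconj
  rw [IsHyperbolic, abs_trace_eq_of_isConj_proj hconj] at hh
  exact absurd hh (by decide)

lemma isReciprocal_reciprocalClass {l : List ℤˣ} (hl : l ≠ []) :
    IsReciprocal (reciprocalClass l) := by
  have hh := isHyperbolic_wordMat_append_negReverse hl
  refine ⟨_, hh, by rw [proj_wordMat, reciprocalClass], UpperHalfPlane.I, ?_, matA, orderOf_A, ?_⟩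
  · rw [mem_axis_iff hh, axisForm, wordMat_append_negReverse_symm]
    simp
  · rw [smul_eq_self_iff, fixedPointForm]
    simp [matA]

theorem isReciprocal_iff {c : ConjClasses PSL2Z} :
    IsReciprocal c ↔ ∃ l, l ≠ [] ∧ c = reciprocalClass l := by
  refine ⟨exists_eq_reciprocalClass, ?_⟩
  rintro ⟨l, hl, rfl⟩
  exact isReciprocal_reciprocalClass hl

/-! ### Runs of equal signs -/

/-- The number of maximal runs of equal signs of length greater than `D`. -/
def longRuns (D : ℕ) (l : List ℤˣ) : ℕ :=
  (runs l).countP fun r => D < r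

lemma runs_append {l m : List ℤˣ} (h : ∀ x ∈ l.getLast?, ∀ y ∈ m.head?, x ≠ y) :
    runs (l ++ m) = runs l ++ runs m := by
  rw [runs, List.splitBy_append fun x hx y hy => by simpa using h x hx y hy, List.map_append]
  rfl

lemma runs_replicate {k : ℕ} (hk : 0 < k) (e : ℤˣ) : runs (List.replicate k e) = [k] := by
  rw [runs, List.splitBy_of_isChain (by simp [hk.ne'])]
  · simp
  · exact List.Pairwise.isChain (by simp [List.pairwise_replicate])

lemma longRuns_nil (D : ℕ) : longRuns D [] = 0 := rfl

lemma ne_nil_of_longRuns_ne_zero {D : ℕ} {l : List ℤˣ} (h : longRuns D l ≠ 0) : l ≠ [] := by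
  rintro rfl
  exact h (longRuns_nil D)

lemma longRuns_append (D : ℕ) {l m : List ℤˣ} (h : l.getLast? ≠ m.head?) :
    longRuns D (l ++ m) = longRuns D l + longRuns D m := by
  rw [longRuns, runs_append, List.countP_append]
  · rfl
  · rintro x hx _ hy rfl
    exact h ((Option.mem_def.mp hx).trans (Option.mem_def.mp hy).symm)

lemma longRuns_flatten_replicate (D : ℕ) {w : List ℤˣ} (hw : w.head? ≠ w.getLast?) (n : ℕ) :
    longRuns D (List.replicate n w).flatten = n * longRuns D w := by
  have hw0 : w ≠ [] := by rintro rfl; exact hw rfl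
  induction n with
  | zero => simp [longRuns_nil]
  | succ n ih =>
    rcases n with _ | n
    · simp
    · rw [List.replicate_succ, List.flatten_cons, longRuns_append, ih]
      · ring
      · rw [List.replicate_succ, List.flatten_cons, List.head?_append_of_ne_nil _ hw0]
        exact hw.symm

lemma longRuns_eq_of_isRotated (D : ℕ) {l l' : List ℤˣ} (h : l ~r l')
    (hl : l.head? ≠ l.getLast?) (hl' : l'.head? ≠ l'.getLast?) :
    longRuns D l = longRuns D l' := by
  obtain ⟨a, b, rfl, rfl⟩ := exists_eq_append_of_isRotated h
  rcases eq_or_ne a [] with rfl | ha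
  · simp
  rcases eq_or_ne b [] with rfl | hb
  · simp
  rw [List.head?_append_of_ne_nil _ ha, List.getLast?_append_of_ne_nil _ hb] at hl
  rw [List.head?_append_of_ne_nil _ hb, List.getLast?_append_of_ne_nil _ ha] at hl'
  rw [longRuns_append D hl'.symm, longRuns_append D hl.symm, add_comm]

/-- The sign sequence that starts with the sign `e` and has the given run lengths. -/
def expand : ℤˣ → List ℕ → List ℤˣ
  | _, [] => []
  | e, k :: ks => List.replicate k e ++ expand (-e) ks

lemma length_expand (e : ℤˣ) (ks : List ℕ) : (expand e ks).length = ks.sum := by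
  induction ks generalizing e with
  | nil => rfl
  | cons k ks ih => simp [expand, ih]

lemma head?_expand_cons (e : ℤˣ) {k : ℕ} (hk : 0 < k) (ks : List ℕ) :
    (expand e (k :: ks)).head? = some e := by
  simp [expand, List.head?_append, List.head?_replicate, hk.ne']

lemma eq_of_mem_head?_expand {e f : ℤˣ} {ks : List ℕ} (h : ∀ k ∈ ks, 0 < k)
    (hf : f ∈ (expand e ks).head?) : f = e := by
  rcases ks with _ | ⟨k, ks⟩
  · simp [expand] at hf
  · rw [head?_expand_cons e (h k (by simp))] at hf
    exact (Option.some_injective _ hf).symm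

lemma runs_expand (e : ℤˣ) {ks : List ℕ} (h : ∀ k ∈ ks, 0 < k) : runs (expand e ks) = ks := by
  induction ks generalizing e with
  | nil => rfl
  | cons k ks ih =>
    obtain ⟨hk, hks⟩ := List.forall_mem_cons.mp h
    rw [expand, runs_append, runs_replicate hk, ih _ hks, List.singleton_append]
    intro x hx y hy
    rw [List.eq_of_mem_replicate (List.mem_of_getLast? hx), eq_of_mem_head?_expand hks hy]
    exact units_ne_neg_self e

lemma exists_eq_expand (l : List ℤˣ) : ∃ e ks, (∀ k ∈ ks, 0 < k) ∧ l = expand e ks := by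
  induction l with
  | nil => exact ⟨1, [], by simp [expand]⟩
  | cons x l ih =>
    obtain ⟨e, ks, hks, rfl⟩ := ih
    rcases ks with _ | ⟨k, ks⟩
    · exact ⟨x, [1], by simp [expand]⟩
    by_cases hx : x = e
    · subst hx
      refine ⟨x, (k + 1) :: ks, ?_, by simp [expand, List.replicate_succ]⟩
      exact List.forall_mem_cons.mpr ⟨k.succ_pos, (List.forall_mem_cons.mp hks).2⟩
    · refine ⟨x, 1 :: k :: ks, List.forall_mem_cons.mpr ⟨one_pos, hks⟩, ?_⟩
      simp [expand, Int.units_ne_iff_eq_neg.mp hx]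

lemma head?_negReverse (l : List ℤˣ) : (negReverse l).head? = l.getLast?.map Neg.neg := by
  simp [negReverse]

lemma getLast?_negReverse (l : List ℤˣ) : (negReverse l).getLast? = l.head?.map Neg.neg := by
  simp [negReverse]

lemma runs_negReverse_expand (e : ℤˣ) {ks : List ℕ} (h : ∀ k ∈ ks, 0 < k) :
    runs (negReverse (expand e ks)) = ks.reverse := by
  induction ks generalizing e with
  | nil => rfl
  | cons k ks ih =>
    obtain ⟨hk, hks⟩ := List.forall_mem_cons.mp h
    have hrep : negReverse (List.replicate k e) = List.replicate k (-e) := by simp [negReverse]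
    rw [expand, negReverse_append, hrep, runs_append, runs_replicate hk, ih _ hks,
      List.reverse_cons]
    intro x hx y hy
    rw [Option.mem_def, getLast?_negReverse, Option.map_eq_some_iff] at hx
    obtain ⟨z, hz, rfl⟩ := hx
    rw [List.eq_of_mem_replicate (List.mem_of_head? hy), eq_of_mem_head?_expand hks hz, neg_neg]
    exact units_ne_neg_self e

lemma longRuns_negReverse (D : ℕ) (l : List ℤˣ) : longRuns D (negReverse l) = longRuns D l := by
  obtain ⟨e, ks, hks, rfl⟩ := exists_eq_expand l
  rw [longRuns, longRuns, runs_negReverse_expand e hks, runs_expand e hks, List.countP_reverse]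

lemma head?_ne_getLast?_append_negReverse {l : List ℤˣ} (hl : l ≠ []) :
    (l ++ negReverse l).head? ≠ (l ++ negReverse l).getLast? := by
  obtain ⟨x, l, rfl⟩ := List.exists_cons_of_ne_nil hl
  rw [negReverse_cons, ← List.append_assoc, List.getLast?_concat]
  simp

lemma longRuns_append_negReverse (D : ℕ) (l : List ℤˣ) :
    longRuns D (l ++ negReverse l) = 2 * longRuns D l := by
  rcases List.eq_nil_or_concat' l with rfl | ⟨m, x, rfl⟩
  · rfl
  · rw [longRuns_append, longRuns_negReverse, two_mul]
    simp [head?_negReverse]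

/-! ### Rotations of symmetric sign sequences -/

lemma exists_eq_append_negReverse {l : List ℤˣ} (h : negReverse l = l) :
    ∃ a, l = a ++ negReverse a := by
  induction l using List.bidirectionalRec with
  | nil => exact ⟨[], rfl⟩
  | singleton x => exact absurd (by simpa [negReverse] using h.symm) (units_ne_neg_self x)
  | cons_append x l y ih =>
    rw [negReverse_cons, negReverse_append, negReverse_cons, negReverse_nil, List.nil_append,
      List.singleton_append, List.cons_append, List.cons.injEq] at h
    obtain ⟨hl, hy⟩ := List.append_inj' h.2 rfl
    obtain ⟨a, rfl⟩ := ih hl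
    exact ⟨x :: a, by rw [negReverse_cons, ← hy, List.cons_append, List.append_assoc]⟩

lemma negReverse_ne_self {D : ℕ} {l : List ℤˣ} (hl : longRuns D l = 1) : negReverse l ≠ l := by
  intro h
  obtain ⟨a, rfl⟩ := exists_eq_append_negReverse h
  rw [longRuns_append_negReverse] at hl
  omega

lemma flatten_replicate_eq_of_append_comm {α : Type*} {x y : List α} (h : x ++ y = y ++ x) :
    (List.replicate y.length x).flatten = (List.replicate x.length y).flatten := by
  have hpow (n : ℕ) (w : List α) :
      (List.replicate n w).flatten = (FreeMonoid.ofList w ^ n).toList := by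
    rw [← List.prod_replicate, FreeMonoid.toList_prod, List.map_replicate]
    rfl
  have hcomm : Commute (FreeMonoid.ofList x) (FreeMonoid.ofList y) := h
  have happend : (List.replicate y.length x).flatten ++ (List.replicate x.length y).flatten =
      (List.replicate x.length y).flatten ++ (List.replicate y.length x).flatten := by
    rw [hpow, hpow]
    exact hcomm.pow_pow y.length x.length
  exact List.append_inj_left happend (by simp [mul_comm])

-- Both sides count, up to a factor, the long runs of the common power of the commuting words
-- `a ++ b` and `a ++ negReverse a`.
lemma length_mul_longRuns_eq {D : ℕ} {a b : List ℤˣ} (hab : negReverse (a ++ b) = a ++ b)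
    (hba : negReverse (b ++ a) = b ++ a) (hne : (a ++ b).head? ≠ (a ++ b).getLast?) :
    a.length * longRuns D (a ++ b) = (a ++ b).length * longRuns D a := by
  rcases eq_or_ne a [] with rfl | ha
  · simp [longRuns_nil]
  have hcomm : (a ++ b) ++ (a ++ negReverse a) = (a ++ negReverse a) ++ (a ++ b) := by
    calc (a ++ b) ++ (a ++ negReverse a) = a ++ negReverse (b ++ a) ++ negReverse a := by
          rw [hba]; simp only [List.append_assoc]
      _ = (a ++ negReverse a) ++ negReverse (a ++ b) := by
          simp only [negReverse_append, List.append_assoc]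
      _ = (a ++ negReverse a) ++ (a ++ b) := by rw [hab]
  have hruns := congrArg (longRuns D) (flatten_replicate_eq_of_append_comm hcomm)
  rw [longRuns_flatten_replicate D hne,
    longRuns_flatten_replicate D (head?_ne_getLast?_append_negReverse ha),
    longRuns_append_negReverse, List.length_append, length_negReverse] at hruns
  linarith

lemma eq_or_eq_negReverse_of_isRotated {D : ℕ} {l l' : List ℤˣ} (hl : longRuns D l = 1)
    (h : l ++ negReverse l ~r l' ++ negReverse l') : l' = l ∨ l' = negReverse l := by
  have hl0 : l ≠ [] := ne_nil_of_longRuns_ne_zero (hl ▸ one_ne_zero)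
  have hlen : l.length = l'.length := by
    have := h.perm.length_eq
    simp only [List.length_append, length_negReverse] at this
    omega
  obtain ⟨a, b, hab, hba⟩ := exists_eq_append_of_isRotated h
  have hlenab : a.length + b.length = 2 * l.length := by
    rw [← List.length_append, ← hab, List.length_append, length_negReverse, two_mul]
  have ha : a.length = l.length * longRuns D a := by
    have := length_mul_longRuns_eq (D := D) (a := a) (b := b)
      (hab ▸ negReverse_append_self l) (hba ▸ negReverse_append_self l')
      (hab ▸ head?_ne_getLast?_append_negReverse hl0)
    rw [← hab, longRuns_append_negReverse, hl, List.length_append, length_negReverse] at this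
    linarith
  have hlpos := List.length_pos_iff.mpr hl0
  have hcases : longRuns D a ≤ 2 := by
    by_contra! h3
    have := Nat.mul_le_mul_left l.length h3
    omega
  interval_cases longRuns D a
  · obtain rfl := List.length_eq_zero_iff.mp ha
    rw [List.append_nil, ← List.nil_append b, ← hab] at hba
    exact Or.inl (List.append_inj_left hba hlen.symm)
  · have hb : b = negReverse l := (List.append_inj_right hab (by omega)).symm
    exact Or.inr ((List.append_inj_left hba (by omega)).trans hb)
  · obtain rfl := List.length_eq_zero_iff.mp (show b.length = 0 by omega)
    rw [List.nil_append, ← List.append_nil a, ← hab] at hba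
    exact Or.inl (List.append_inj_left hba hlen.symm)

/-! ### Counting reciprocal classes by sign sequences -/

lemma wordLength_reciprocalClass (l : List ℤˣ) :
    wordLength (reciprocalClass l) = 4 * l.length := by
  rw [reciprocalClass, wordLength_mk_signWord, List.length_append, length_negReverse]
  ring

lemma hasExcursions_reciprocalClass_iff {D k : ℕ} {l : List ℤˣ} (hl : l ≠ []) :
    HasExcursions D k (reciprocalClass l) ↔ 2 * longRuns D l = k := by
  have hne := head?_ne_getLast?_append_negReverse hl
  rw [← longRuns_append_negReverse]
  constructor
  · rintro ⟨ε, ⟨hε, hmk⟩, hcount⟩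
    have hrot := isRotated_of_isConj_signWord (ConjClasses.mk_eq_mk_iff_isConj.mp hmk)
    exact (longRuns_eq_of_isRotated D hrot hε hne).symm.trans hcount
  · exact fun hcount => ⟨_, ⟨hne, rfl⟩, hcount⟩

lemma reciprocalClass_eq_iff {D : ℕ} {l l' : List ℤˣ} (hl : longRuns D l = 1) :
    reciprocalClass l' = reciprocalClass l ↔ l' = l ∨ l' = negReverse l := by
  constructor
  · intro h
    exact eq_or_eq_negReverse_of_isRotated hl
      (isRotated_of_isConj_signWord (ConjClasses.mk_eq_mk_iff_isConj.mp h.symm))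
  · rintro (rfl | rfl)
    · rfl
    · rw [reciprocalClass, negReverse_involutive]
      exact ConjClasses.mk_eq_mk_iff_isConj.mpr
        (isConj_signWord_of_isRotated List.isRotated_append)

/-- The sign sequences of length `t` with exactly one maximal run longer than `D`. -/
def singleLongRun (D t : ℕ) : Set (List ℤˣ) :=
  {l | l.length = t ∧ longRuns D l = 1}

lemma finite_singleLongRun (D t : ℕ) : (singleLongRun D t).Finite :=
  (List.finite_length_eq ℤˣ t).subset fun _ h => h.1

lemma setOf_excursionSet_eq_image (D t : ℕ) :
    {c ∈ excursionSet D 2 | wordLength c = 4 * t} = reciprocalClass '' singleLongRun D t := by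
  ext c
  constructor
  · rintro ⟨⟨hc, hexc⟩, hlen⟩
    obtain ⟨l, hl, rfl⟩ := isReciprocal_iff.mp hc
    rw [hasExcursions_reciprocalClass_iff hl] at hexc
    rw [wordLength_reciprocalClass] at hlen
    exact ⟨l, ⟨by omega, by omega⟩, rfl⟩
  · rintro ⟨l, ⟨hlen, hlong⟩, rfl⟩
    have hl : l ≠ [] := ne_nil_of_longRuns_ne_zero (hlong ▸ one_ne_zero)
    exact ⟨⟨isReciprocal_reciprocalClass hl, (hasExcursions_reciprocalClass_iff hl).mpr
      (by rw [hlong])⟩, by rw [wordLength_reciprocalClass, hlen]⟩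

lemma two_mul_ncard_image {α β : Type*} {f : α → β} {σ : α → α} {s : Set α} (hs : s.Finite)
    (hσ : ∀ x ∈ s, σ x ∈ s ∧ σ x ≠ x)
    (hf : ∀ x ∈ s, ∀ y ∈ s, f y = f x ↔ y = x ∨ y = σ x) :
    2 * (f '' s).ncard = s.ncard := by
  classical
  lift s to Finset α using hs
  simp only [Finset.mem_coe] at hσ hf
  rw [← Finset.coe_image, Set.ncard_coe_finset, Set.ncard_coe_finset,
    Finset.card_eq_sum_card_image f s, mul_comm]
  symm
  refine Finset.sum_const_nat fun c hc => ?_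
  obtain ⟨x, hx, rfl⟩ := Finset.mem_image.mp hc
  rw [Finset.card_eq_two]
  refine ⟨x, σ x, (hσ x hx).2.symm, Finset.ext fun y => ?_⟩
  simp only [Finset.mem_filter, Finset.mem_insert, Finset.mem_singleton]
  constructor
  · exact fun ⟨hy, h⟩ => (hf x hx y hy).mp h
  · rintro (rfl | rfl)
    · exact ⟨hx, rfl⟩
    · exact ⟨(hσ x hx).1, (hf x hx _ (hσ x hx).1).mpr (Or.inr rfl)⟩

lemma two_mul_ncard_excursionSet (D t : ℕ) :
    2 * {c ∈ excursionSet D 2 | wordLength c = 4 * t}.ncard = (singleLongRun D t).ncard := by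
  rw [setOf_excursionSet_eq_image]
  refine two_mul_ncard_image (σ := negReverse) (finite_singleLongRun D t) ?_ ?_
  · rintro l ⟨hlen, hlong⟩
    exact ⟨⟨(length_negReverse l).trans hlen, (longRuns_negReverse D l).trans hlong⟩,
      negReverse_ne_self hlong⟩
  · exact fun l hl l' _ => reciprocalClass_eq_iff hl.2

/-- The compositions of `t` with exactly `j` parts greater than `D`. -/
def longCompositions (D j t : ℕ) : Set (List ℕ) :=
  {ks | (∀ k ∈ ks, 0 < k) ∧ ks.sum = t ∧ ks.countP (fun k => D < k) = j}

lemma singleLongRun_eq_image (D t : ℕ) :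
    singleLongRun D t =
      (fun p : ℤˣ × List ℕ => expand p.1 p.2) '' (Set.univ ×ˢ longCompositions D 1 t) := by
  ext l
  constructor
  · rintro ⟨hlen, hlong⟩
    obtain ⟨e, ks, hks, rfl⟩ := exists_eq_expand l
    rw [length_expand] at hlen
    rw [longRuns, runs_expand e hks] at hlong
    exact ⟨(e, ks), ⟨trivial, hks, hlen, hlong⟩, rfl⟩
  · rintro ⟨⟨e, ks⟩, ⟨-, hks, hsum, hcount⟩, rfl⟩
    exact ⟨(length_expand e ks).trans hsum, by rw [longRuns, runs_expand e hks, hcount]⟩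

lemma ncard_singleLongRun (D t : ℕ) :
    (singleLongRun D t).ncard = 2 * (longCompositions D 1 t).ncard := by
  rw [singleLongRun_eq_image, Set.InjOn.ncard_image, Set.ncard_prod, Set.ncard_univ]
  · simp
  · rintro ⟨e, ks⟩ ⟨-, hks, -, hcount⟩ ⟨e', ks'⟩ ⟨-, hks', -⟩ (h : expand e ks = expand e' ks')
    simp only at hks hcount hks'
    obtain rfl : ks = ks' := by rw [← runs_expand e hks, h, runs_expand e' hks']
    rcases ks with _ | ⟨k, ks⟩
    · simp at hcount
    · have hk := hks k List.mem_cons_self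
      have hhead := congrArg List.head? h
      rw [head?_expand_cons e hk, head?_expand_cons e' hk] at hhead
      rw [Option.some_injective _ hhead]

theorem ncard_excursionSet (D t : ℕ) :
    {c ∈ excursionSet D 2 | wordLength c = 4 * t}.ncard = (longCompositions D 1 t).ncard := by
  have h := two_mul_ncard_excursionSet D t
  rw [ncard_singleLongRun] at h
  omega

/-! ### Generating functions of compositions -/

lemma finite_longCompositions (D j t : ℕ) : (longCompositions D j t).Finite := by
  refine (Set.finite_range fun c : Composition t => c.blocks).subset ?_
  rintro ks ⟨hks, hsum, -⟩
  exact ⟨⟨ks, fun {i} hi => hks i hi, hsum⟩, rfl⟩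

lemma longCompositions_zero_right (D j : ℕ) :
    longCompositions D j 0 = if j = 0 then {[]} else ∅ := by
  have hnil {ks : List ℕ} (hks : ∀ k ∈ ks, 0 < k) (hsum : ks.sum = 0) : ks = [] :=
    List.eq_nil_iff_forall_not_mem.mpr fun k hk =>
      (hks k hk).ne' (List.sum_eq_zero_iff.mp hsum k hk)
  split_ifs with hj <;> ext ks <;> constructor
  · exact fun h => hnil h.1 h.2.1
  · rintro rfl
    simp [longCompositions, hj]
  · rintro ⟨hks, hsum, hcount⟩
    rw [hnil hks hsum] at hcount
    exact hj hcount.symm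
  · exact False.elim

lemma ncard_eq_sum_ncard_cons {α : Type*} {S : Set (List α)} (hS : S.Finite) {s : Finset α}
    (h : ∀ l ∈ S, ∃ k ∈ s, ∃ ks, l = k :: ks) :
    S.ncard = ∑ k ∈ s, {ks | k :: ks ∈ S}.ncard := by
  classical
  have hmap : Set.MapsTo List.head? (hS.toFinset : Set (List α)) (s.image some) := by
    intro l hl
    obtain ⟨k, hk, ks, rfl⟩ := h l (by simpa using hl)
    simpa using hk
  rw [Set.ncard_eq_toFinset_card S hS, Finset.card_eq_sum_card_fiberwise hmap,
    Finset.sum_image (Option.some_injective α).injOn]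
  refine Finset.sum_congr rfl fun k _ => ?_
  rw [← Set.ncard_image_of_injective {ks | k :: ks ∈ S} (List.cons_injective (a := k)),
    ← Set.ncard_coe_finset]
  congr 1
  ext l
  rcases l with _ | ⟨x, l⟩
  · simp
  · simp only [Finset.coe_filter, Set.Finite.mem_toFinset, Set.mem_ofPred_eq, Set.mem_image,
      List.head?_cons, Option.some_inj, List.cons.injEq]
    grind

lemma ncard_longCompositions_eq_sum (D j : ℕ) {t : ℕ} (ht : 0 < t) :
    (longCompositions D j t).ncard =
      ∑ k ∈ Finset.range (t + 1), {ks | k :: ks ∈ longCompositions D j t}.ncard := by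
  refine ncard_eq_sum_ncard_cons (finite_longCompositions D j t) ?_
  rintro (_ | ⟨k, ks⟩) ⟨-, hsum, -⟩
  · exact absurd hsum ht.ne
  · rw [List.sum_cons] at hsum
    exact ⟨k, Finset.mem_range.mpr (by omega), ks, rfl⟩

lemma cons_mem_longCompositions_iff {D j t k : ℕ} {ks : List ℕ} (hkt : k ≤ t) :
    k :: ks ∈ longCompositions D j t ↔
      0 < k ∧ ∃ i, j = i + (if D < k then 1 else 0) ∧ ks ∈ longCompositions D i (t - k) := by
  simp only [longCompositions, Set.mem_ofPred_eq, List.forall_mem_cons, List.sum_cons,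
    List.countP_cons, decide_eq_true_eq]
  grind

/-- The generating function of the compositions with exactly `j` parts greater than `D`. -/
noncomputable def compSeries (D j : ℕ) : PowerSeries ℝ :=
  PowerSeries.mk fun t => ((longCompositions D j t).ncard : ℝ)

/-- The generating function `z + z² + ⋯ + z ^ D` of the parts that are at most `D`. -/
noncomputable def shortSeries (D : ℕ) : PowerSeries ℝ :=
  PowerSeries.mk fun k => if 1 ≤ k ∧ k ≤ D then 1 else 0

/-- The generating function of the parts that are greater than `D`. -/
noncomputable def longSeries (D : ℕ) : PowerSeries ℝ :=
  PowerSeries.mk fun k => if D < k then 1 else 0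

lemma coeff_mul_eq_sum_range {R : Type*} [CommSemiring R] (f g : PowerSeries R) (n : ℕ) :
    PowerSeries.coeff n (f * g) =
      ∑ k ∈ Finset.range (n + 1), PowerSeries.coeff k f * PowerSeries.coeff (n - k) g := by
  rw [PowerSeries.coeff_mul, Finset.Nat.sum_antidiagonal_eq_sum_range_succ_mk]

lemma compSeries_zero (D : ℕ) : compSeries D 0 * (1 - shortSeries D) = 1 := by
  suffices compSeries D 0 = 1 + shortSeries D * compSeries D 0 by linear_combination this
  ext t
  rw [map_add, coeff_mul_eq_sum_range, PowerSeries.coeff_one]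
  simp only [compSeries, shortSeries, PowerSeries.coeff_mk]
  rcases Nat.eq_zero_or_pos t with rfl | ht
  · simp [longCompositions_zero_right]
  rw [if_neg ht.ne', zero_add, ncard_longCompositions_eq_sum D 0 ht, Nat.cast_sum]
  refine Finset.sum_congr rfl fun k hk => ?_
  have hcons := fun ks => @cons_mem_longCompositions_iff D 0 t k ks
    (Nat.lt_succ_iff.mp (Finset.mem_range.mp hk))
  simp only [hcons]
  by_cases hkD : D < k
  · simp [hkD, hkD.not_ge]
  · by_cases hk0 : 0 < k <;> simp [hk0, hkD, Nat.succ_le_iff, not_lt.mp hkD]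

lemma compSeries_succ (D j : ℕ) :
    compSeries D (j + 1) * (1 - shortSeries D) = longSeries D * compSeries D j := by
  suffices compSeries D (j + 1) =
      shortSeries D * compSeries D (j + 1) + longSeries D * compSeries D j by
    linear_combination this
  ext t
  rw [map_add, coeff_mul_eq_sum_range, coeff_mul_eq_sum_range, ← Finset.sum_add_distrib]
  simp only [compSeries, shortSeries, longSeries, PowerSeries.coeff_mk]
  rcases Nat.eq_zero_or_pos t with rfl | ht
  · simp [longCompositions_zero_right]
  rw [ncard_longCompositions_eq_sum D (j + 1) ht, Nat.cast_sum]
  refine Finset.sum_congr rfl fun k hk => ?_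
  have hcons := fun ks => @cons_mem_longCompositions_iff D (j + 1) t k ks
    (Nat.lt_succ_iff.mp (Finset.mem_range.mp hk))
  simp only [hcons]
  by_cases hkD : D < k
  · simp [hkD, hkD.not_ge, (Nat.zero_le D).trans_lt hkD]
  · by_cases hk0 : 0 < k <;> simp [hk0, hkD, Nat.succ_le_iff, not_lt.mp hkD]

lemma compSeries_one (D : ℕ) :
    compSeries D 1 = longSeries D * (compSeries D 0 * compSeries D 0) := by
  linear_combination compSeries D 0 * compSeries_succ D 0 - compSeries D 1 * compSeries_zero D

/-! ### The growth rate -/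

section Root

variable {D : ℕ} {α β : ℝ}

lemma IsPosRoot.pow_eq (h : IsPosRoot D α) : α ^ D = ∑ i ∈ Finset.range D, α ^ i :=
  sub_eq_zero.mp h.2

lemma IsPosRoot.ne_zero (h : IsPosRoot D α) : D ≠ 0 := by
  rintro rfl
  simpa using h.pow_eq

lemma IsPosRoot.one_lt (h : IsPosRoot D α) (hD : 2 ≤ D) : 1 < α := by
  by_contra! hle
  have h0 := h.1
  have hpow : α ^ D ≤ 1 := pow_le_one₀ h0.le hle
  have hsum : ∑ i ∈ Finset.range 2, α ^ i ≤ ∑ i ∈ Finset.range D, α ^ i :=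
    Finset.sum_le_sum_of_subset_of_nonneg (Finset.range_subset_range.mpr hD)
      fun _ _ _ => by positivity
  rw [← h.pow_eq, Finset.sum_range_succ, Finset.sum_range_one, pow_zero, pow_one] at hsum
  linarith

lemma IsPosRoot.pow_mul (h : IsPosRoot D α) : α ^ D * (2 - α) = 1 := by
  have hgeom := geom_sum_mul α D
  rw [← h.pow_eq] at hgeom
  linarith

lemma IsPosRoot.inv_pow (h : IsPosRoot D α) : α⁻¹ ^ D = 2 - α := by
  rw [_root_.inv_pow]
  exact inv_eq_of_mul_eq_one_right h.pow_mul

lemma IsPosRoot.lt_two (h : IsPosRoot D α) : α < 2 := by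
  have hpow : 0 < α⁻¹ ^ D := pow_pos (inv_pos.mpr h.1) D
  rw [h.inv_pow] at hpow
  linarith

/-- The function `z ↦ (1 + z + ⋯ + z ^ (D - 1)) / z ^ D` is strictly decreasing on `z > 0`;
the proof compares two of its values after clearing denominators. -/
lemma IsPosRoot.le (hα : IsPosRoot D α) (hβ : IsPosRoot D β) : β ≤ α := by
  by_contra! hlt
  have hα0 := hα.1
  have hβ0 := hβ.1
  have hsum : ∑ i ∈ Finset.range D, β ^ i * α ^ D < ∑ i ∈ Finset.range D, α ^ i * β ^ D := by
    refine Finset.sum_lt_sum_of_nonempty (Finset.nonempty_range_iff.mpr hα.ne_zero) fun i hi => ?_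
    obtain ⟨k, rfl⟩ := Nat.exists_eq_add_of_lt (Finset.mem_range.mp hi)
    calc β ^ i * α ^ (i + k + 1) = α ^ i * β ^ i * α ^ (k + 1) := by ring
      _ < α ^ i * β ^ i * β ^ (k + 1) := by gcongr
      _ = α ^ i * β ^ (i + k + 1) := by ring
  rw [← Finset.sum_mul, ← Finset.sum_mul, ← hα.pow_eq, ← hβ.pow_eq, mul_comm] at hsum
  exact lt_irrefl _ hsum

theorem existsUnique_isPosRoot (hD : D ≠ 0) : ∃! α : ℝ, IsPosRoot D α := by
  have hcont : Continuous fun z : ℝ => z ^ D - ∑ i ∈ Finset.range D, z ^ i := by fun_prop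
  have hone : (1 : ℝ) ^ D - ∑ i ∈ Finset.range D, (1 : ℝ) ^ i ≤ 0 := by
    have : (1 : ℝ) ≤ D := Nat.one_le_cast.mpr (Nat.one_le_iff_ne_zero.mpr hD)
    simpa using this
  have htwo : 0 ≤ (2 : ℝ) ^ D - ∑ i ∈ Finset.range D, (2 : ℝ) ^ i := by
    linarith [geom_sum_mul (2 : ℝ) D]
  obtain ⟨α, ⟨hα1, -⟩, hα⟩ :=
    intermediate_value_Icc one_le_two hcont.continuousOn ⟨hone, htwo⟩
  have hroot : IsPosRoot D α := ⟨by linarith, hα⟩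
  exact ⟨α, hroot, fun β hβ => le_antisymm (hroot.le hβ) (hβ.le hroot)⟩

end Root

/-! ### Limits of recurrences and convolutions -/

lemma abs_sum_mul_le {ι : Type*} {s : Finset ι} {g v : ι → ℝ} {C : ℝ} (hv : ∀ j ∈ s, |v j| ≤ C) :
    |∑ j ∈ s, g j * v j| ≤ (∑ j ∈ s, |g j|) * C := by
  rw [Finset.sum_mul]
  refine (Finset.abs_sum_le_sum_abs _ _).trans (Finset.sum_le_sum fun j hj => ?_)
  rw [abs_mul]
  exact mul_le_mul_of_nonneg_left (hv j hj) (abs_nonneg _)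

section Recurrence

variable {u g : ℕ → ℝ} {m : ℕ}

lemma exists_abs_le_of_recurrence (hg : ∑ j ∈ Finset.range m, |g j| ≤ 1)
    (hu : ∀ n, m ≤ n → u n = ∑ j ∈ Finset.range m, g j * u (n - (j + 1))) :
    ∃ K, ∀ n, |u n| ≤ K := by
  refine ⟨∑ i ∈ Finset.range m, |u i|, fun n => ?_⟩
  have hK : 0 ≤ ∑ i ∈ Finset.range m, |u i| := Finset.sum_nonneg fun _ _ => abs_nonneg _
  induction n using Nat.strong_induction_on with
  | h n ih =>
    rcases lt_or_ge n m with hn | hn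
    · exact Finset.single_le_sum (f := fun i => |u i|) (fun _ _ => abs_nonneg _)
        (Finset.mem_range.mpr hn)
    · rw [hu n hn]
      refine (abs_sum_mul_le fun j hj => ih _ ?_).trans (mul_le_of_le_one_left hK hg)
      have := Finset.mem_range.mp hj
      omega

lemma tendsto_zero_of_recurrence (hg : ∑ j ∈ Finset.range m, |g j| < 1)
    (hu : ∀ n, m ≤ n → u n = ∑ j ∈ Finset.range m, g j * u (n - (j + 1))) :
    Tendsto u atTop (𝓝 0) := by
  obtain ⟨K, hK⟩ := exists_abs_le_of_recurrence hg.le hu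
  set θ := ∑ j ∈ Finset.range m, |g j|
  have hθ0 : 0 ≤ θ := Finset.sum_nonneg fun _ _ => abs_nonneg _
  have hdecay : ∀ k n, k * (m + 1) ≤ n → |u n| ≤ θ ^ k * K := by
    intro k
    induction k with
    | zero => exact fun n _ => by simpa using hK n
    | succ k ih =>
      intro n hn
      rw [add_one_mul] at hn
      rw [hu n (by omega), pow_succ', mul_assoc]
      refine abs_sum_mul_le fun j hj => ih _ ?_
      have := Finset.mem_range.mp hj
      omega
  have hlim : Tendsto (fun n => θ ^ (n / (m + 1)) * K) atTop (𝓝 0) := by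
    simpa using ((tendsto_pow_atTop_nhds_zero_of_lt_one hθ0 hg).comp
      (Nat.tendsto_div_const_atTop m.succ_ne_zero)).mul_const K
  exact squeeze_zero_norm (fun n => hdecay _ n (Nat.div_mul_le_self n (m + 1))) hlim

end Recurrence

lemma exists_abs_le_of_tendsto {x : ℕ → ℝ} {a : ℝ} (hx : Tendsto x atTop (𝓝 a)) :
    ∃ M, ∀ n, |x n| ≤ M := by
  obtain ⟨M, hM⟩ := hx.abs.bddAbove_range
  exact ⟨M, fun n => hM ⟨n, rfl⟩⟩

lemma tendsto_sum_range_succ_div {x : ℕ → ℝ} {a : ℝ} (hx : Tendsto x atTop (𝓝 a)) :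
    Tendsto (fun n : ℕ => (∑ k ∈ Finset.range (n + 1), x k) / ((n : ℝ) + 1)) atTop (𝓝 a) := by
  refine (hx.cesaro.comp (tendsto_add_atTop_nat 1)).congr fun n => ?_
  simp only [Function.comp_apply, Nat.cast_add, Nat.cast_one, div_eq_inv_mul]

section Convolution

variable {x y : ℕ → ℝ} {a b : ℝ}

lemma tendsto_convolution_div_zero {M : ℝ} (hx : Tendsto x atTop (𝓝 0)) (hy : ∀ n, |y n| ≤ M) :
    Tendsto (fun n : ℕ => (∑ k ∈ Finset.range (n + 1), x k * y (n - k)) / ((n : ℝ) + 1)) atTop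
      (𝓝 0) := by
  have hces : Tendsto (fun n : ℕ => (∑ k ∈ Finset.range (n + 1), |x k|) / ((n : ℝ) + 1) * M)
      atTop (𝓝 0) := by
    simpa using (tendsto_sum_range_succ_div hx.abs).mul_const M
  refine squeeze_zero_norm (fun n => ?_) hces
  have hn : (0 : ℝ) < n + 1 := by positivity
  rw [Real.norm_eq_abs, abs_div, abs_of_pos hn, div_mul_eq_mul_div]
  exact div_le_div_of_nonneg_right (abs_sum_mul_le fun k _ => hy _) hn.le

lemma tendsto_convolution_div_of_tendsto (hx : Tendsto x atTop (𝓝 a)) (hy : Tendsto y atTop (𝓝 b)) :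
    Tendsto (fun n : ℕ => (∑ k ∈ Finset.range (n + 1), x k * y (n - k)) / ((n : ℝ) + 1)) atTop
      (𝓝 (a * b)) := by
  obtain ⟨M, hM⟩ := exists_abs_le_of_tendsto hy
  have hsplit : ∀ n : ℕ, ∑ k ∈ Finset.range (n + 1), x k * y (n - k) =
      ∑ k ∈ Finset.range (n + 1), (x k - a) * y (n - k) + a * ∑ k ∈ Finset.range (n + 1), y k := by
    intro n
    rw [← Finset.sum_range_reflect y, Finset.mul_sum, ← Finset.sum_add_distrib]
    exact Finset.sum_congr rfl fun k _ => by rw [add_tsub_cancel_right]; ring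
  have hx0 : Tendsto (fun n => x n - a) atTop (𝓝 0) := tendsto_sub_nhds_zero_iff.mpr hx
  have hlim := (tendsto_convolution_div_zero hx0 hM).add
    ((tendsto_sum_range_succ_div hy).const_mul a)
  rw [zero_add] at hlim
  exact hlim.congr fun n => by rw [hsplit, add_div, mul_div_assoc]

lemma tendsto_div_add_add_one (hy : Tendsto (fun n : ℕ => y n / ((n : ℝ) + 1)) atTop (𝓝 b))
    (k : ℕ) : Tendsto (fun n : ℕ => y n / (((n + k : ℕ) : ℝ) + 1)) atTop (𝓝 b) := by
  have hratio := (tendsto_natCast_div_add_atTop (k : ℝ)).comp (tendsto_add_atTop_nat 1)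
  have hlim := hy.mul hratio
  rw [mul_one] at hlim
  refine hlim.congr fun n => ?_
  simp only [Function.comp_apply]
  push_cast
  field_simp
  ring

lemma tendsto_convolution_div_of_hasSum (hx : HasSum x a)
    (hy : Tendsto (fun n : ℕ => y n / ((n : ℝ) + 1)) atTop (𝓝 b)) :
    Tendsto (fun n : ℕ => (∑ k ∈ Finset.range (n + 1), x k * y (n - k)) / ((n : ℝ) + 1)) atTop
      (𝓝 (a * b)) := by
  obtain ⟨M, hM⟩ := exists_abs_le_of_tendsto hy
  have hM0 : 0 ≤ M := (abs_nonneg _).trans (hM 0)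
  let F (n k : ℕ) : ℝ := if k ≤ n then x k * (y (n - k) / ((n : ℝ) + 1)) else 0
  have hF : ∀ n : ℕ, ∑' k, F n k =
      (∑ k ∈ Finset.range (n + 1), x k * y (n - k)) / ((n : ℝ) + 1) := by
    intro n
    rw [tsum_eq_sum (s := Finset.range (n + 1)) fun k hk => if_neg (by simpa using hk),
      Finset.sum_div]
    exact Finset.sum_congr rfl fun k hk => by
      rw [mul_div_assoc]; exact if_pos (Finset.mem_range_succ_iff.mp hk)
  simp only [← hF]
  rw [← hx.tsum_eq, ← tsum_mul_right]
  refine tendsto_tsum_of_dominated_convergence (bound := fun k => |x k| * M)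
    (hx.summable.abs.mul_right M) (fun k => ?_) (Eventually.of_forall fun n k => ?_)
  · rw [← tendsto_add_atTop_iff_nat k]
    refine ((tendsto_div_add_add_one hy k).const_mul (x k)).congr fun n => ?_
    simp only [F, Nat.le_add_left, if_true, Nat.add_sub_cancel]
  · simp only [F]
    split_ifs with hk
    · rw [norm_mul, Real.norm_eq_abs, Real.norm_eq_abs]
      refine mul_le_mul_of_nonneg_left (le_trans ?_ (hM (n - k))) (abs_nonneg _)
      rw [abs_div, abs_div]
      gcongr
      · exact Nat.sub_le n k
    · simpa using mul_nonneg (abs_nonneg (x k)) hM0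

end Convolution

/-! ### The asymptotic number of compositions -/

section Asymptotics

variable {D : ℕ} {α : ℝ}

/-- The tail sums `α⁻¹ ^ (j + 1) + ⋯ + α⁻¹ ^ D`. At the root of `z ^ D = z ^ (D - 1) + ⋯ + 1` the
weights `α⁻¹ ^ k`, `1 ≤ k ≤ D`, form a probability distribution, and these are the probabilities
that a random part exceeds `j`. -/
noncomputable def tailSum (D : ℕ) (α : ℝ) (j : ℕ) : ℝ :=
  ∑ k ∈ Finset.Ioc j D, α⁻¹ ^ k

lemma tailSum_of_le (D : ℕ) (α : ℝ) {j : ℕ} (hj : D ≤ j) : tailSum D α j = 0 := by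
  rw [tailSum, Finset.Ioc_eq_empty_of_le hj, Finset.sum_empty]

lemma tailSum_eq_add (α : ℝ) {j : ℕ} (hj : j < D) :
    tailSum D α j = α⁻¹ ^ (j + 1) + tailSum D α (j + 1) := by
  rw [tailSum, tailSum, ← Finset.insert_Ioc_succ_left_eq_Ioc hj]
  simp

lemma tailSum_nonneg (h : 0 ≤ α) (j : ℕ) : 0 ≤ tailSum D α j :=
  Finset.sum_nonneg fun _ _ => by positivity

lemma mul_tailSum (hα : α ≠ 0) {j : ℕ} (hj : j ≤ D) :
    (α - 1) * tailSum D α j = α⁻¹ ^ j - α⁻¹ ^ D := by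
  induction hj using Nat.decreasingInduction with
  | self => rw [tailSum_of_le D α le_rfl, mul_zero, sub_self]
  | of_succ j hj ih =>
    rw [tailSum_eq_add α hj, mul_add, ih, pow_succ]
    field_simp
    ring

lemma IsPosRoot.tailSum_zero (h : IsPosRoot D α) (hD : 2 ≤ D) : tailSum D α 0 = 1 := by
  have hα : α - 1 ≠ 0 := (sub_pos.mpr (h.one_lt hD)).ne'
  refine mul_left_cancel₀ hα ?_
  rw [mul_tailSum h.1.ne' D.zero_le, h.inv_pow]
  ring

lemma IsPosRoot.sum_tailSum (h : IsPosRoot D α) (hD : 2 ≤ D) :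
    ∑ j ∈ Finset.range D, tailSum D α j = (2 + ((D : ℝ) + 1) * (α - 2)) / (α - 1) := by
  have hα : α - 1 ≠ 0 := (sub_pos.mpr (h.one_lt hD)).ne'
  have hgeom : ∑ j ∈ Finset.range D, α⁻¹ ^ j = α := by
    have hne : α⁻¹ - 1 ≠ 0 := sub_ne_zero.mpr (inv_lt_one_of_one_lt₀ (h.one_lt hD)).ne
    refine mul_right_cancel₀ hne ?_
    rw [geom_sum_mul, h.inv_pow, mul_sub, mul_inv_cancel₀ h.1.ne']
    ring
  rw [eq_div_iff hα, mul_comm, Finset.mul_sum, Finset.sum_congr rfl fun j hj =>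
    mul_tailSum h.1.ne' (Finset.mem_range.mp hj).le, Finset.sum_sub_distrib, hgeom, h.inv_pow,
    Finset.sum_const, Finset.card_range, nsmul_eq_mul]
  ring

lemma IsPosRoot.sum_tailSum_lt_two (h : IsPosRoot D α) (hD : 2 ≤ D) :
    ∑ j ∈ Finset.range D, tailSum D α j < 2 := by
  have hα1 := h.one_lt hD
  have hα2 := h.lt_two
  have hD' : (2 : ℝ) ≤ D := Nat.ofNat_le_cast.mpr hD
  rw [h.sum_tailSum hD, div_lt_iff₀ (by linarith)]
  nlinarith

lemma mk_tailSum_mul (h : IsPosRoot D α) (hD : 2 ≤ D) :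
    PowerSeries.mk (tailSum D α) * (1 - PowerSeries.X) =
      1 - PowerSeries.rescale α⁻¹ (shortSeries D) := by
  ext n
  rw [mul_sub, mul_one, map_sub, map_sub, PowerSeries.coeff_rescale, PowerSeries.coeff_one,
    shortSeries, PowerSeries.coeff_mk, PowerSeries.coeff_mk]
  rcases n with _ | n
  · simp [h.tailSum_zero hD]
  · rw [PowerSeries.coeff_succ_mul_X, PowerSeries.coeff_mk, if_neg n.succ_ne_zero]
    rcases lt_or_ge n D with hn | hn
    · rw [tailSum_eq_add α hn, if_pos ⟨by omega, hn⟩]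
      ring
    · rw [tailSum_of_le D α hn, tailSum_of_le D α (by omega), if_neg (by omega)]
      ring

/-- The number of compositions of `n` with all parts at most `D`, divided by `α ^ n`. -/
noncomputable def scaledCount (D : ℕ) (α : ℝ) (n : ℕ) : ℝ :=
  PowerSeries.coeff n (PowerSeries.rescale α⁻¹ (compSeries D 0))

lemma sum_tailSum_mul_scaledCount (h : IsPosRoot D α) (hD : 2 ≤ D) (n : ℕ) :
    ∑ k ∈ Finset.range (n + 1), tailSum D α k * scaledCount D α (n - k) = 1 := by
  have hcomp := congrArg (PowerSeries.rescale α⁻¹) (compSeries_zero D)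
  rw [map_mul, map_sub, map_one, ← mk_tailSum_mul h hD] at hcomp
  have hprod : PowerSeries.mk (tailSum D α) * PowerSeries.rescale α⁻¹ (compSeries D 0) =
      PowerSeries.mk 1 := by
    linear_combination PowerSeries.mk 1 * hcomp - PowerSeries.mk (tailSum D α) *
      PowerSeries.rescale α⁻¹ (compSeries D 0) * PowerSeries.mk_one_mul_one_sub_eq_one ℝ
  simpa only [coeff_mul_eq_sum_range, PowerSeries.coeff_mk, Pi.one_apply, scaledCount] using
    congrArg (PowerSeries.coeff n) hprod

lemma scaledCount_eq_one_sub_sum (h : IsPosRoot D α) (hD : 2 ≤ D) {n : ℕ} (hn : D - 1 ≤ n) :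
    scaledCount D α n =
      1 - ∑ j ∈ Finset.range (D - 1), tailSum D α (j + 1) * scaledCount D α (n - (j + 1)) := by
  have hsum := sum_tailSum_mul_scaledCount h hD n
  have hvanish : ∀ k ∈ Finset.range (n + 1), k ∉ Finset.range (D - 1 + 1) →
      tailSum D α k * scaledCount D α (n - k) = 0 := by
    intro k _ hk
    rw [Finset.mem_range] at hk
    rw [tailSum_of_le D α (by omega), zero_mul]
  rw [← Finset.sum_subset (Finset.range_subset_range.mpr (by omega)) hvanish,
    Finset.sum_range_succ', h.tailSum_zero hD, one_mul, Nat.sub_zero] at hsum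
  linarith

/-- A renewal theorem: the limit is the reciprocal of the mean part `∑ k * α⁻¹ ^ k`. -/
lemma tendsto_scaledCount (h : IsPosRoot D α) (hD : 2 ≤ D) :
    Tendsto (scaledCount D α) atTop (𝓝 (dConst D α)) := by
  set μ := ∑ j ∈ Finset.range D, tailSum D α j with hμ
  have hd : dConst D α = μ⁻¹ := by rw [hμ, h.sum_tailSum hD, inv_div, dConst]
  have htail : ∑ j ∈ Finset.range (D - 1), tailSum D α (j + 1) = μ - 1 := by
    rw [hμ, ← Nat.sub_add_cancel (one_le_two.trans hD), Finset.sum_range_succ',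
      Nat.sub_add_cancel (one_le_two.trans hD), h.tailSum_zero hD, add_sub_cancel_right]
  have htail0 : 0 ≤ μ - 1 := htail ▸ Finset.sum_nonneg fun j _ => tailSum_nonneg h.1.le (j + 1)
  have hμ0 : μ ≠ 0 := by linarith
  rw [hd, ← tendsto_sub_nhds_zero_iff]
  refine tendsto_zero_of_recurrence (m := D - 1) (g := fun j => -tailSum D α (j + 1)) ?_ ?_
  · simp only [abs_neg, abs_of_nonneg (tailSum_nonneg h.1.le _), htail]
    linarith [h.sum_tailSum_lt_two hD]
  · intro n hn
    rw [scaledCount_eq_one_sub_sum h hD hn]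
    simp only [neg_mul, mul_sub, Finset.sum_neg_distrib, Finset.sum_sub_distrib, ← Finset.sum_mul,
      htail, sub_mul, mul_inv_cancel₀ hμ0]
    ring

lemma hasSum_rescale_longSeries (D : ℕ) (hα : 1 < α) :
    HasSum (fun k => PowerSeries.coeff k (PowerSeries.rescale α⁻¹ (longSeries D)))
      (1 / (α ^ D * (α - 1))) := by
  have hα0 : 0 < α := one_pos.trans hα
  have hα1 : α - 1 ≠ 0 := (sub_pos.mpr hα).ne'
  simp only [PowerSeries.coeff_rescale, longSeries, PowerSeries.coeff_mk]
  rw [← hasSum_nat_add_iff' (D + 1), Finset.sum_eq_zero fun k hk => by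
    rw [if_neg (by simpa [Nat.lt_succ_iff] using hk), mul_zero], sub_zero]
  have hgeom := (hasSum_geometric_of_lt_one (inv_nonneg.mpr hα0.le)
    (inv_lt_one_of_one_lt₀ hα)).mul_left (α⁻¹ ^ (D + 1))
  have hval : α⁻¹ ^ (D + 1) * (1 - α⁻¹)⁻¹ = 1 / (α ^ D * (α - 1)) := by
    rw [pow_succ, inv_pow]
    field_simp
  rw [hval] at hgeom
  refine hgeom.congr_fun fun k => ?_
  rw [if_pos (by omega), mul_one, pow_add, mul_comm]

lemma ncard_longCompositions_one_div_pow (D : ℕ) (α : ℝ) (t : ℕ) :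
    ((longCompositions D 1 t).ncard : ℝ) / α ^ t =
      ∑ k ∈ Finset.range (t + 1),
        PowerSeries.coeff k (PowerSeries.rescale α⁻¹ (longSeries D)) *
          ∑ i ∈ Finset.range (t - k + 1), scaledCount D α i * scaledCount D α (t - k - i) := by
  have hcoeff : PowerSeries.coeff t (PowerSeries.rescale α⁻¹ (compSeries D 1)) =
      ((longCompositions D 1 t).ncard : ℝ) / α ^ t := by
    rw [PowerSeries.coeff_rescale, compSeries, PowerSeries.coeff_mk, inv_pow, div_eq_inv_mul]
  rw [← hcoeff, compSeries_one, map_mul (PowerSeries.rescale α⁻¹),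
    map_mul (PowerSeries.rescale α⁻¹)]
  simp only [coeff_mul_eq_sum_range, scaledCount]

theorem tendsto_ncard_longCompositions (h : IsPosRoot D α) (hD : 2 ≤ D) :
    Tendsto (fun t : ℕ => ((longCompositions D 1 t).ncard : ℝ) / ((t : ℝ) * α ^ t)) atTop
      (𝓝 (dConst D α ^ 2 / (α ^ D * (α - 1)))) := by
  have hscaled := tendsto_scaledCount h hD
  have hlim := (tendsto_convolution_div_of_hasSum (hasSum_rescale_longSeries D (h.one_lt hD))
    (tendsto_convolution_div_of_tendsto hscaled hscaled)).div
    (tendsto_natCast_div_add_atTop (1 : ℝ)) one_ne_zero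
  rw [div_one, one_div_mul_eq_div, ← sq] at hlim
  refine hlim.congr fun t => ?_
  rw [Pi.div_apply, ← ncard_longCompositions_one_div_pow,
    div_div_div_cancel_right₀ (Nat.cast_add_one_ne_zero t), div_div, mul_comm (α ^ t)]

end Asymptotics

end ReciprocalGeodesics

theorem theorem3p2 (D : ℕ) (hD : 2 ≤ D) :
    (∃! α : ℝ, ReciprocalGeodesics.IsPosRoot D α) ∧
    (∀ t : ℕ, {c ∈ ReciprocalGeodesics.excursionSet D 2 |
      ReciprocalGeodesics.wordLength c = 4 * t}.Finite) ∧
    ∀ α : ℝ, ReciprocalGeodesics.IsPosRoot D α →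
      Tendsto
        (fun t : ℕ =>
          (({c ∈ ReciprocalGeodesics.excursionSet D 2 |
              ReciprocalGeodesics.wordLength c = 4 * t}.ncard : ℕ) : ℝ) / ((t : ℝ) * α ^ t))
        atTop
        (𝓝 (ReciprocalGeodesics.dConst D α ^ 2 / (α ^ D * (α - 1)))) := by
  refine ⟨ReciprocalGeodesics.existsUnique_isPosRoot (by omega), fun t => ?_, fun α hα => ?_⟩
  · rw [ReciprocalGeodesics.setOf_excursionSet_eq_image]
    exact (ReciprocalGeodesics.finite_singleLongRun D t).image _
  · simp only [ReciprocalGeodesics.ncard_excursionSet]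
    exact ReciprocalGeodesics.tendsto_ncard_longCompositions hα hD
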